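/- For $N\ge 3$ let $IHa(N)$ be the real Lie algebra, of dimension $\frac{N(N-1)}{2}+4N+3$, with basis $J_{ij}$ ($1\le i<j\le N$), $G_k,F_k,Q_k,P_k$ ($1\le k\le N$), $R,E,T$, with $J_{ji}=-J_{ij}$ and the brackets $$[J_{ij},J_{kl}]=\delta_{il}J_{jk}+\delta_{jk}J_{il}-\delta_{jl}J_{ik}-\delta_{ik}J_{jl},\qquad [J_{ij},V_k]=-\delta_{ik}V_j+\delta_{jk}V_i\quad (V\in\{G,F,Q,P\}),$$ $$[G_i,F_j]=\delta_{ij}R,\quad [G_i,Q_j]=\delta_{ij}T,\quad [F_i,P_j]=\delta_{ij}T,\quad [E,G_i]=-P_i,\quad [E,F_i]=Q_i,\quad [E,R]=2T,$$ all other brackets of basis elements being zero. For a real Lie algebra $\mathfrak g$ of dimension $n$ with basis $X_1,\dots,X_n$ and structure constants $[X_i,X_j]=\sum_k C_{ij}^kX_k$, let $x_1,\dots,x_n$ be the corresponding linear coordinates on $\mathfrak g^*$. An invariant of $\mathfrak g$ on an open set $U\subseteq\mathfrak g^*$ is a function $F\in C^\infty(U)$ with $\sum_{j,k}C_{ij}^k\,x_k\,\partial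 F/\partial x_j=0$ on $U$ for $1\le i\le n$. Invariants $F_1,\dots,F_m$ on $U$ are functionally independent if their differentials are linearly independent at the points of a dense subset of $U$. Let $$\mathcal N(\mathfrak g)=\dim\mathfrak g-\sup_{x}\operatorname{rank}\Bigl(\sum_k C_{ij}^kx_k\Bigr)_{i,j}.$$ Let $\omega_1,\dots,\omega_n$ be the dual basis, let $d\omega_k=-\sum_{i<j}C_{ij}^k\,\omega_i\wedge\omega_j$, and let $\mathcal L(\mathfrak g)\subseteq\bigwedge^2\mathfrak g^*$ be the span of the $d\omega_k$. For $\omega\in\mathcal L(\mathfrak g)$ let $j_0(\omega)$ be the largest $m$ with $\bigwedge^m\omega\ne0$, and let $j_0(\mathfrak g)=\max_{\omega\in\mathcal L(\mathfrak g)}j_0(\omega)$. Then, for every $N\ge3$ and every basis of $\mathfrak g=IHa(N)$: (i) for every nonempty open $U\subseteq\mathfrak g^*$ (in particular $U=\mathfrak g^*$), the maximal number of functionally independent invariants of $\mathfrak g$ on $U$ is exactly $\left[\frac N2\right]+1$; (ii) $\mathcal N(\mathfrak g)=\left[\frac N2\right]+1$; (iii) $\mathcal N(\mathfrak g)=\dim\mathfrak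 g-2j_0(\mathfrak g)$. -/

import Mathlib

open scoped Matrix ContDiff

/-! ### Invariants of a real Lie algebra in coordinates

`X` is a basis of the Lie algebra `g`. The elements of `X` are linear coordinates on the dual
space, so a point of the dual space is given by its coordinate vector `x : ι → ℝ`. -/

section Invariants

variable {ι g : Type*} [Fintype ι] [LieRing g] [LieAlgebra ℝ g]

/-- The structure constants: `⁅X i, X j⁆ = ∑ k, C i j k • X k`. -/
noncomputable def structConst (X : Module.Basis ι ℝ g) (i j k : ι) : ℝ :=
  X.repr ⁅X i, X j⁆ k

/-- The matrix `A(g) = (∑ k, C i j k * x k)` of the commutator table, at the point `x`. -/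
noncomputable def commutatorMatrix (X : Module.Basis ι ℝ g) (x : ι → ℝ) : Matrix ι ι ℝ :=
  Matrix.of fun i j => ∑ k, structConst X i j k * x k

/-- `dim g - sup_x rank A(g)(x)`. Each rank is at most `dim g`: the supremum is a maximum and
the subtraction does not truncate. -/
noncomputable def numInvariants (X : Module.Basis ι ℝ g) : ℕ :=
  Module.finrank ℝ g - ⨆ x : ι → ℝ, (commutatorMatrix X x).rank

/-- The differential operator `X̂ᵢ = ∑ j k, C i j k * x k * ∂/∂x j`. -/
noncomputable def coadjointOperator [DecidableEq ι] (X : Module.Basis ι ℝ g) (i : ι)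
    (F : (ι → ℝ) → ℝ) (x : ι → ℝ) : ℝ :=
  ∑ j, ∑ k, structConst X i j k * x k * fderiv ℝ F x (Pi.single j 1)

/-- `F` is a smooth invariant on the open set `U` of the dual space: `X̂ᵢ F = 0` for all `i`. -/
def IsInvariantOn [DecidableEq ι] (X : Module.Basis ι ℝ g) (U : Set (ι → ℝ))
    (F : (ι → ℝ) → ℝ) : Prop :=
  ContDiffOn ℝ ∞ F U ∧ ∀ i, ∀ x ∈ U, coadjointOperator X i F x = 0

/-- Functional independence on the open set `U`: the differentials are linearly independent at
the points of a dense subset of `U`. -/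
def FunctionallyIndependentOn {m : ℕ} (U : Set (ι → ℝ)) (F : Fin m → (ι → ℝ) → ℝ) : Prop :=
  U ⊆ closure {x | x ∈ U ∧ LinearIndependent ℝ fun a => fderiv ℝ (F a) x}

/-- The Maurer-Cartan 2-form `dω_k = -∑_{i<j} C i j k ω_i ∧ ω_j` in the exterior algebra of the
dual space, where `ω` is the dual basis of `X`. The sum is written over all pairs `(i, j)`, with
a factor `1/2`, so that no order on the index set is needed. -/
noncomputable def maurerCartanForm (X : Module.Basis ι ℝ g) (k : ι) :
    ExteriorAlgebra ℝ (Module.Dual ℝ g) :=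
  -((1 / 2 : ℝ) • ∑ i, ∑ j, structConst X i j k •
    (ExteriorAlgebra.ι ℝ (X.coord i) * ExteriorAlgebra.ι ℝ (X.coord j)))

/-- The space `L(g)` spanned by the 2-forms `dω_k`. -/
noncomputable def maurerCartanSpace (X : Module.Basis ι ℝ g) :
    Submodule ℝ (ExteriorAlgebra ℝ (Module.Dual ℝ g)) :=
  Submodule.span ℝ (Set.range (maurerCartanForm X))

/-- `j₀(w)`: the largest `m` such that the `m`-fold wedge power of `w` is nonzero. -/
noncomputable def formRank (w : ExteriorAlgebra ℝ (Module.Dual ℝ g)) : ℕ :=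
  sSup {m : ℕ | w ^ m ≠ 0}

/-- `j₀(g)`: the maximum of `j₀(w)` over `w ∈ L(g)`. -/
noncomputable def jZero (X : Module.Basis ι ℝ g) : ℕ :=
  ⨆ w : maurerCartanSpace X, formRank (w : ExteriorAlgebra ℝ (Module.Dual ℝ g))

end Invariants

/-! ### The inhomogeneous Hamilton algebra -/

/-- The underlying space of the inhomogeneous Hamilton algebra `IHa(N)`. The element with
components `(J, G, F, Q, P, R, E, T)` is
`∑_{i<j} J i j • J_ij + ∑ k, (G k • G_k + F k • F_k + Q k • Q_k + P k • P_k) + R • R + E • E + T • T`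
in the usual generators; the skew-symmetric matrix of `J_ij` is `E_ij - E_ji`. -/
@[ext]
structure IHa (N : ℕ) where
  J : LieAlgebra.Orthogonal.so (Fin N) ℝ
  G : Fin N → ℝ
  F : Fin N → ℝ
  Q : Fin N → ℝ
  P : Fin N → ℝ
  R : ℝ
  E : ℝ
  T : ℝ

namespace IHa

variable {N : ℕ}

/-- The components of an element, as a tuple. -/
def equivProd (N : ℕ) : IHa N ≃ LieAlgebra.Orthogonal.so (Fin N) ℝ × (Fin N → ℝ) × (Fin N → ℝ) ×
    (Fin N → ℝ) × (Fin N → ℝ) × ℝ × ℝ × ℝ where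
  toFun a := (a.J, a.G, a.F, a.Q, a.P, a.R, a.E, a.T)
  invFun p := ⟨p.1, p.2.1, p.2.2.1, p.2.2.2.1, p.2.2.2.2.1, p.2.2.2.2.2.1, p.2.2.2.2.2.2.1,
    p.2.2.2.2.2.2.2⟩
  left_inv _ := rfl
  right_inv _ := rfl

noncomputable instance : AddCommGroup (IHa N) := (equivProd N).addCommGroup

noncomputable instance : Module ℝ (IHa N) := (equivProd N).module ℝ

/-- The bracket, extended bilinearly from its values on the generators, which are listed in the
lemmas below. -/
noncomputable instance : Bracket (IHa N) (IHa N) where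
  bracket a b :=
    { J := ⁅a.J, b.J⁆
      G := a.J.1 *ᵥ b.G - b.J.1 *ᵥ a.G
      F := a.J.1 *ᵥ b.F - b.J.1 *ᵥ a.F
      Q := a.J.1 *ᵥ b.Q - b.J.1 *ᵥ a.Q + (a.E • b.F - b.E • a.F)
      P := a.J.1 *ᵥ b.P - b.J.1 *ᵥ a.P - (a.E • b.G - b.E • a.G)
      R := a.G ⬝ᵥ b.F - b.G ⬝ᵥ a.F
      E := 0
      T := (a.G ⬝ᵥ b.Q - b.G ⬝ᵥ a.Q) + (a.F ⬝ᵥ b.P - b.F ⬝ᵥ a.P) + 2 * (a.E * b.R - b.E * a.R) }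

section Components

variable (a b : IHa N) (c : ℝ)

@[simp] theorem zero_J : (0 : IHa N).J = 0 := rfl
@[simp] theorem zero_G : (0 : IHa N).G = 0 := rfl
@[simp] theorem zero_F : (0 : IHa N).F = 0 := rfl
@[simp] theorem zero_Q : (0 : IHa N).Q = 0 := rfl
@[simp] theorem zero_P : (0 : IHa N).P = 0 := rfl
@[simp] theorem zero_R : (0 : IHa N).R = 0 := rfl
@[simp] theorem zero_E : (0 : IHa N).E = 0 := rfl
@[simp] theorem zero_T : (0 : IHa N).T = 0 := rfl

@[simp] theorem add_J : (a + b).J = a.J + b.J := rfl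
@[simp] theorem add_G : (a + b).G = a.G + b.G := rfl
@[simp] theorem add_F : (a + b).F = a.F + b.F := rfl
@[simp] theorem add_Q : (a + b).Q = a.Q + b.Q := rfl
@[simp] theorem add_P : (a + b).P = a.P + b.P := rfl
@[simp] theorem add_R : (a + b).R = a.R + b.R := rfl
@[simp] theorem add_E : (a + b).E = a.E + b.E := rfl
@[simp] theorem add_T : (a + b).T = a.T + b.T := rfl

@[simp] theorem sub_J : (a - b).J = a.J - b.J := rfl
@[simp] theorem sub_G : (a - b).G = a.G - b.G := rfl
@[simp] theorem sub_F : (a - b).F = a.F - b.F := rfl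
@[simp] theorem sub_Q : (a - b).Q = a.Q - b.Q := rfl
@[simp] theorem sub_P : (a - b).P = a.P - b.P := rfl
@[simp] theorem sub_R : (a - b).R = a.R - b.R := rfl
@[simp] theorem sub_E : (a - b).E = a.E - b.E := rfl
@[simp] theorem sub_T : (a - b).T = a.T - b.T := rfl

@[simp] theorem neg_J : (-a).J = -a.J := rfl
@[simp] theorem neg_G : (-a).G = -a.G := rfl
@[simp] theorem neg_F : (-a).F = -a.F := rfl
@[simp] theorem neg_Q : (-a).Q = -a.Q := rfl
@[simp] theorem neg_P : (-a).P = -a.P := rfl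
@[simp] theorem neg_R : (-a).R = -a.R := rfl
@[simp] theorem neg_E : (-a).E = -a.E := rfl
@[simp] theorem neg_T : (-a).T = -a.T := rfl

@[simp] theorem smul_J : (c • a).J = c • a.J := rfl
@[simp] theorem smul_G : (c • a).G = c • a.G := rfl
@[simp] theorem smul_F : (c • a).F = c • a.F := rfl
@[simp] theorem smul_Q : (c • a).Q = c • a.Q := rfl
@[simp] theorem smul_P : (c • a).P = c • a.P := rfl
@[simp] theorem smul_R : (c • a).R = c * a.R := rfl
@[simp] theorem smul_E : (c • a).E = c * a.E := rfl
@[simp] theorem smul_T : (c • a).T = c * a.T := rfl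

@[simp] theorem lie_J : ⁅a, b⁆.J = ⁅a.J, b.J⁆ := rfl
@[simp] theorem lie_G : ⁅a, b⁆.G = a.J.1 *ᵥ b.G - b.J.1 *ᵥ a.G := rfl
@[simp] theorem lie_F : ⁅a, b⁆.F = a.J.1 *ᵥ b.F - b.J.1 *ᵥ a.F := rfl
@[simp] theorem lie_Q :
    ⁅a, b⁆.Q = a.J.1 *ᵥ b.Q - b.J.1 *ᵥ a.Q + (a.E • b.F - b.E • a.F) := rfl
@[simp] theorem lie_P :
    ⁅a, b⁆.P = a.J.1 *ᵥ b.P - b.J.1 *ᵥ a.P - (a.E • b.G - b.E • a.G) := rfl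
@[simp] theorem lie_R : ⁅a, b⁆.R = a.G ⬝ᵥ b.F - b.G ⬝ᵥ a.F := rfl
@[simp] theorem lie_E : ⁅a, b⁆.E = 0 := rfl
@[simp] theorem lie_T : ⁅a, b⁆.T =
    (a.G ⬝ᵥ b.Q - b.G ⬝ᵥ a.Q) + (a.F ⬝ᵥ b.P - b.F ⬝ᵥ a.P) + 2 * (a.E * b.R - b.E * a.R) := rfl

end Components

theorem mulVec_dot (A : LieAlgebra.Orthogonal.so (Fin N) ℝ) (v w : Fin N → ℝ) :
    (A.1 *ᵥ v) ⬝ᵥ w = -(v ⬝ᵥ (A.1 *ᵥ w)) := by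
  have h : (A.1)ᵀ = -A.1 := (LieAlgebra.Orthogonal.mem_so (Fin N) ℝ A.1).1 A.2
  rw [dotProduct_comm, Matrix.dotProduct_mulVec, ← Matrix.mulVec_transpose, h,
    Matrix.neg_mulVec, neg_dotProduct, dotProduct_comm]

theorem lie_mulVec (A B : LieAlgebra.Orthogonal.so (Fin N) ℝ) (v : Fin N → ℝ) :
    (⁅A, B⁆ : LieAlgebra.Orthogonal.so (Fin N) ℝ).1 *ᵥ v
      = A.1 *ᵥ (B.1 *ᵥ v) - B.1 *ᵥ (A.1 *ᵥ v) := by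
  have : (⁅A, B⁆ : LieAlgebra.Orthogonal.so (Fin N) ℝ).1 = A.1 * B.1 - B.1 * A.1 := rfl
  rw [this, Matrix.sub_mulVec, Matrix.mulVec_mulVec, Matrix.mulVec_mulVec]

noncomputable instance : LieRing (IHa N) where
  add_lie a b c := by
    ext1 <;> simp [Matrix.add_mulVec, Matrix.mulVec_add, add_smul, smul_add, add_dotProduct,
      dotProduct_add] <;> ring1
  lie_add a b c := by
    ext1 <;> simp [Matrix.add_mulVec, Matrix.mulVec_add, add_smul, smul_add, add_dotProduct,
      dotProduct_add] <;> ring1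
  lie_self a := by
    ext1 <;> simp
  leibniz_lie a b c := by
    ext1
    · simp
    case T =>
      simp only [lie_G, lie_F, lie_Q, lie_P, lie_R, lie_E, lie_T, add_T, dotProduct_add,
        sub_dotProduct, dotProduct_sub, dotProduct_smul, mulVec_dot, smul_eq_mul]
      rw [dotProduct_comm c.G (b.J.1 *ᵥ a.Q), dotProduct_comm c.G (a.J.1 *ᵥ b.Q),
        dotProduct_comm c.F (b.J.1 *ᵥ a.P), dotProduct_comm c.F (a.J.1 *ᵥ b.P),
        dotProduct_comm c.G b.F, dotProduct_comm c.G a.F, dotProduct_comm c.F b.G,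
        dotProduct_comm c.F a.G, dotProduct_comm b.F a.G, dotProduct_comm b.G a.F]
      simp only [mulVec_dot]
      rw [dotProduct_comm a.Q (b.J.1 *ᵥ c.G), dotProduct_comm b.Q (a.J.1 *ᵥ c.G),
        dotProduct_comm a.P (b.J.1 *ᵥ c.F), dotProduct_comm b.P (a.J.1 *ᵥ c.F)]
      simp only [mulVec_dot]
      ring1
    case R =>
      simp only [lie_G, lie_F, lie_R, add_R, dotProduct_sub, sub_dotProduct, mulVec_dot]
      rw [dotProduct_comm c.G (b.J.1 *ᵥ a.F), dotProduct_comm c.G (a.J.1 *ᵥ b.F)]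
      simp only [mulVec_dot]
      ring1
    case E => simp
    all_goals
      simp only [lie_J, lie_G, lie_F, lie_Q, lie_P, lie_E, add_G, add_F, add_Q,
        add_P, lie_mulVec, Matrix.mulVec_add, Matrix.mulVec_sub,
        Matrix.mulVec_smul, smul_sub, zero_smul]
      abel1

noncomputable instance : LieAlgebra ℝ (IHa N) where
  lie_smul c a b := by
    ext1
    case J => simp
    case E => simp
    case R => simp; ring1
    case T => simp; ring1
    all_goals
      simp [Matrix.smul_mulVec, Matrix.mulVec_smul, smul_sub, smul_smul, mul_comm]

/-! The generators and their brackets. -/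

/-- The generator `J_ij`, with `J_ji = -J_ij`. -/
def genJ (i j : Fin N) : IHa N where
  J := ⟨Matrix.single i j 1 - Matrix.single j i 1, by
    rw [LieAlgebra.Orthogonal.mem_so]; simp⟩
  G := 0
  F := 0
  Q := 0
  P := 0
  R := 0
  E := 0
  T := 0

/-- The generator `G_k`. -/
def genG (k : Fin N) : IHa N := ⟨0, Pi.single k 1, 0, 0, 0, 0, 0, 0⟩

/-- The generator `F_k`. -/
def genF (k : Fin N) : IHa N := ⟨0, 0, Pi.single k 1, 0, 0, 0, 0, 0⟩

/-- The generator `Q_k`. -/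
def genQ (k : Fin N) : IHa N := ⟨0, 0, 0, Pi.single k 1, 0, 0, 0, 0⟩

/-- The generator `P_k`. -/
def genP (k : Fin N) : IHa N := ⟨0, 0, 0, 0, Pi.single k 1, 0, 0, 0⟩

/-- The generator `R`. -/
def genR : IHa N := ⟨0, 0, 0, 0, 0, 1, 0, 0⟩

/-- The generator `E`. -/
def genE : IHa N := ⟨0, 0, 0, 0, 0, 0, 1, 0⟩

/-- The generator `T`. -/
def genT : IHa N := ⟨0, 0, 0, 0, 0, 0, 0, 1⟩

/-- Kronecker's delta. -/
def delta (i j : Fin N) : ℝ := if i = j then 1 else 0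

theorem col_zero (i : Fin N) : (0 : Matrix (Fin N) (Fin N) ℝ).col i = 0 := rfl

theorem so_mulVec_single (i j k : Fin N) :
    (Matrix.single i j (1 : ℝ) - Matrix.single j i 1) *ᵥ Pi.single k 1
      = -delta i k • (Pi.single j 1 : Fin N → ℝ) + delta k j • Pi.single i 1 := by
  ext l
  simp only [Matrix.mulVec_single_one, Matrix.col_apply, Matrix.sub_apply, Matrix.single_apply,
    delta, Pi.add_apply, Pi.smul_apply, Pi.single_apply, smul_eq_mul]
  grind

theorem lie_genJ_genJ (i j k l : Fin N) : ⁅genJ i j, genJ k l⁆ =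
    delta i l • genJ j k + delta j k • genJ i l - delta j l • genJ i k - delta i k • genJ j l := by
  ext1
  case J =>
    apply Subtype.ext
    change (Matrix.single i j (1 : ℝ) - Matrix.single j i 1) *
        (Matrix.single k l 1 - Matrix.single l k 1) -
      (Matrix.single k l 1 - Matrix.single l k 1) *
        (Matrix.single i j 1 - Matrix.single j i 1) =
      delta i l • (Matrix.single j k 1 - Matrix.single k j 1) +
        delta j k • (Matrix.single i l 1 - Matrix.single l i 1) -
        delta j l • (Matrix.single i k 1 - Matrix.single k i 1) -
        delta i k • (Matrix.single j l 1 - Matrix.single l j 1)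
    have h (a b c d : Fin N) : Matrix.single a b (1 : ℝ) * Matrix.single c d 1
        = delta b c • Matrix.single a d 1 := by
      by_cases hbc : b = c
      · subst hbc; simp [delta]
      · simp [delta, hbc]
    have hd (a b : Fin N) : delta a b = delta b a := by simp [delta, eq_comm]
    simp only [sub_mul, mul_sub, h]
    rw [hd l i, hd k i, hd k j, hd l j]
    module
  all_goals simp [genJ]

theorem lie_genJ_genG (i j k : Fin N) :
    ⁅genJ i j, genG k⁆ = -delta i k • genG j + delta k j • genG i := by
  ext1
  case G => simpa [genJ, genG] using so_mulVec_single i j k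
  all_goals simp [genJ, genG]

theorem lie_genJ_genF (i j k : Fin N) :
    ⁅genJ i j, genF k⁆ = -delta i k • genF j + delta k j • genF i := by
  ext1
  case F => simpa [genJ, genF] using so_mulVec_single i j k
  all_goals simp [genJ, genF]

theorem lie_genJ_genQ (i j k : Fin N) :
    ⁅genJ i j, genQ k⁆ = -delta i k • genQ j + delta k j • genQ i := by
  ext1
  case Q => simpa [genJ, genQ] using so_mulVec_single i j k
  all_goals simp [genJ, genQ]

theorem lie_genJ_genP (i j k : Fin N) :
    ⁅genJ i j, genP k⁆ = -delta i k • genP j + delta k j • genP i := by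
  ext1
  case P => simpa [genJ, genP] using so_mulVec_single i j k
  all_goals simp [genJ, genP]

theorem lie_genG_genF (i j : Fin N) : ⁅genG i, genF j⁆ = delta i j • genR := by
  have h : (Pi.single i (1 : ℝ) : Fin N → ℝ) j = delta i j := by
    simp [delta, Pi.single_apply, eq_comm]
  ext1 <;> simp [genG, genF, genR, h, col_zero]

theorem lie_genG_genQ (i j : Fin N) : ⁅genG i, genQ j⁆ = delta i j • genT := by
  have h : (Pi.single i (1 : ℝ) : Fin N → ℝ) j = delta i j := by
    simp [delta, Pi.single_apply, eq_comm]
  ext1 <;> simp [genG, genQ, genT, h, col_zero]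

theorem lie_genF_genP (i j : Fin N) : ⁅genF i, genP j⁆ = delta i j • genT := by
  have h : (Pi.single i (1 : ℝ) : Fin N → ℝ) j = delta i j := by
    simp [delta, Pi.single_apply, eq_comm]
  ext1 <;> simp [genF, genP, genT, h, col_zero]

theorem lie_genE_genG (i : Fin N) : ⁅(genE : IHa N), genG i⁆ = -genP i := by
  ext1 <;> simp [genE, genG, genP, col_zero]

theorem lie_genE_genF (i : Fin N) : ⁅(genE : IHa N), genF i⁆ = genQ i := by
  ext1 <;> simp [genE, genF, genQ, col_zero]

theorem lie_genE_genR : ⁅(genE : IHa N), (genR : IHa N)⁆ = (2 : ℝ) • genT := by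
  ext1 <;> simp [genE, genR, genT]

end IHa

/-! At a point `x` of the dual space, the differential of an invariant lies in the kernel of the
commutator matrix, so independent invariants number at most the corank at `x`. The entries of the
matrix are linear in `x`, so its rank is maximal on a dense open set. Hence the upper bound on any
open set follows from the corank at a single well-chosen point (`card_le_rank_regularPoint`), and
the lower bound follows from enough analytic invariants with independent differentials at one point.
When the two numbers agree, both are exact (`numInvariants_eq_of_invariants`).

The invariants are the central `T` and traces of powers of a matrix `M`, obtained by correcting `T²
J_ij` with quadratic terms in `G, F, Q, P` so that the radical no longer acts on it. The coadjoint
action of `a` then changes `M` by its commutator with the orthogonal part of `a`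
(`coMatrixDeriv_coadjointVector`), and traces of powers do not move.

Both computations are made at the form that is 1 on `T`, a rotation `Y` with distinct frequencies on
the orthogonal algebra, and 0 on the other generators. There `T` pairs `G` with `Q`, `F` with `P`
and `E` with `R` nondegenerately; what remains in the kernel is the centralizer of `Y` and the
centre, of dimension at most `[N/2] + 1`. Independence of the differentials reduces to a Vandermonde
determinant in the squared frequencies.

For the formula with `j₀`: the space spanned by the Maurer-Cartan forms consists of the 2-forms of
the alternating forms `(a, b) ↦ x ⁅a, b⁆`, and the largest nonzero power of a 2-form is half its
rank (`twoFormOf_pow`). -/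

/-! ### Powers of a 2-form and the rank of its alternating form -/

section AlternatingForms

variable {ι V : Type*} [Fintype ι] [AddCommGroup V] [Module ℝ V]

open CliffordAlgebra in
theorem ExteriorAlgebra.contractLeft_ι_mul_ι_mul (d : Module.Dual ℝ V) (a b : V)
    (y : ExteriorAlgebra ℝ V) :
    contractLeft d (ExteriorAlgebra.ι ℝ a * ExteriorAlgebra.ι ℝ b * y) =
      d a • (ExteriorAlgebra.ι ℝ b * y) - d b • (ExteriorAlgebra.ι ℝ a * y) +
        ExteriorAlgebra.ι ℝ a * ExteriorAlgebra.ι ℝ b * contractLeft d y := by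
  rw [mul_assoc]
  erw [contractLeft_ι_mul, contractLeft_ι_mul]
  rw [mul_sub, mul_smul_comm, mul_assoc]
  abel

/-- The element of the exterior algebra of the dual space given by minus an alternating
bilinear form `B`, in the coordinates of a basis. -/
noncomputable def twoFormOf (X : Module.Basis ι ℝ V) (B : V →ₗ[ℝ] Module.Dual ℝ V) :
    ExteriorAlgebra ℝ (Module.Dual ℝ V) :=
  -((1 / 2 : ℝ) • ∑ i, ∑ j, B (X i) (X j) •
    (ExteriorAlgebra.ι ℝ (X.coord i) * ExteriorAlgebra.ι ℝ (X.coord j)))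

theorem sum_apply_smul_ι (X : Module.Basis ι ℝ V) (α : Module.Dual ℝ V) :
    ∑ i, α (X i) • ExteriorAlgebra.ι ℝ (X.coord i) = ExteriorAlgebra.ι ℝ α := by
  classical
  simp only [← map_smul, ← map_sum]
  congr 1
  refine X.ext fun j => ?_
  simp

/-- In the double sum `α ∧ β` appears twice, once from each order, which the factor `1/2` absorbs.
Splitting a hyperbolic plane off `B` thus splits a decomposable term off the 2-form. -/
theorem twoFormOf_smulRight (X : Module.Basis ι ℝ V) (B : V →ₗ[ℝ] Module.Dual ℝ V)
    (α β : Module.Dual ℝ V) :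
    twoFormOf X (B + (α.smulRight β - β.smulRight α)) =
      twoFormOf X B - ExteriorAlgebra.ι ℝ α * ExteriorAlgebra.ι ℝ β := by
  have h (α β : Module.Dual ℝ V) : ∑ i, ∑ j, (α (X i) * β (X j)) •
      (ExteriorAlgebra.ι ℝ (X.coord i) * ExteriorAlgebra.ι ℝ (X.coord j)) =
      ExteriorAlgebra.ι ℝ α * ExteriorAlgebra.ι ℝ β := by
    rw [← sum_apply_smul_ι X α, ← sum_apply_smul_ι X β, Finset.sum_mul_sum]
    simp only [smul_mul_smul_comm]
  have hswap : ExteriorAlgebra.ι ℝ β * ExteriorAlgebra.ι ℝ α =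
      -(ExteriorAlgebra.ι ℝ α * ExteriorAlgebra.ι ℝ β) := by
    rw [eq_neg_iff_add_eq_zero]; exact ExteriorAlgebra.ι_add_mul_swap β α
  simp only [twoFormOf, LinearMap.add_apply, LinearMap.sub_apply, LinearMap.smulRight_apply,
    LinearMap.smul_apply, smul_eq_mul, add_smul, sub_smul, Finset.sum_add_distrib,
    Finset.sum_sub_distrib, h, hswap]
  module

-- Contraction is an antiderivation, and contracting the 2-form itself with `u` gives a multiple of
-- `B u = 0`. The 2-form has even degree, so no sign appears. By induction, contraction with `u`
-- kills all its powers.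
open CliffordAlgebra in
theorem contractLeft_twoFormOf_mul (X : Module.Basis ι ℝ V) {B : V →ₗ[ℝ] Module.Dual ℝ V}
    (hB : ∀ x y, B x y = -B y x) {u : V} (hu : B u = 0)
    (y : ExteriorAlgebra ℝ (Module.Dual ℝ V)) :
    contractLeft (Module.Dual.eval ℝ V u) (twoFormOf X B * y) =
      twoFormOf X B * contractLeft (Module.Dual.eval ℝ V u) y := by
  have h1 (j : ι) : ∑ i, B (X i) (X j) * X.repr u i = 0 := by
    have : B u (X j) = 0 := by rw [hu]; rfl
    rw [← X.sum_repr u] at this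
    simpa only [map_sum, map_smul, LinearMap.sum_apply, LinearMap.smul_apply, smul_eq_mul,
      mul_comm] using this
  have h2 (i : ι) : ∑ j, B (X i) (X j) * X.repr u j = 0 := by
    rw [← neg_eq_zero, ← h1 i, ← Finset.sum_neg_distrib]
    exact Finset.sum_congr rfl fun j _ => by rw [hB (X j)]; ring
  simp only [twoFormOf, neg_mul, smul_mul_assoc, Finset.sum_mul, map_neg, map_smul, map_sum,
    ExteriorAlgebra.contractLeft_ι_mul_ι_mul, smul_add, smul_sub, smul_smul,
    Finset.sum_add_distrib, Finset.sum_sub_distrib]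
  have e1 : ∑ i, ∑ j, (B (X i) (X j) * (Module.Dual.eval ℝ V u) (X.coord i)) •
      (ExteriorAlgebra.ι ℝ (X.coord j) * y) = 0 := by
    rw [Finset.sum_comm]
    refine Finset.sum_eq_zero fun j _ => ?_
    rw [← Finset.sum_smul]
    simp [h1]
  have e2 : ∑ i, ∑ j, (B (X i) (X j) * (Module.Dual.eval ℝ V u) (X.coord j)) •
      (ExteriorAlgebra.ι ℝ (X.coord i) * y) = 0 := by
    refine Finset.sum_eq_zero fun j _ => ?_
    rw [← Finset.sum_smul]
    simp [h2]
  rw [e1, e2]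
  simp

/-- The binomial formula, in which only the terms of degree at most one in `b` survive. -/
theorem add_pow_succ_of_sq_zero {A : Type*} [Ring A] {a b : A} (h : Commute a b)
    (hb : b * b = 0) (m : ℕ) : (a + b) ^ (m + 1) = a ^ (m + 1) + (m + 1) • (b * a ^ m) := by
  induction m with
  | zero => simp
  | succ m ih =>
    have hc : b * a ^ m * a = b * a ^ (m + 1) := by rw [pow_succ, mul_assoc]
    have hd : b * a ^ m * b = 0 := by
      rw [mul_assoc, (h.pow_left m).eq, ← mul_assoc, hb, zero_mul]
    rw [pow_succ, ih, add_mul, mul_add, mul_add, smul_mul_assoc, smul_mul_assoc, hc, hd,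
      (h.pow_left (m + 1)).eq, pow_succ a (m + 1)]
    simp only [smul_zero, add_zero, succ_nsmul]
    abel

/-- Splitting a hyperbolic plane off an alternating form lowers its rank by two. -/
theorem finrank_range_sub_hyperbolic [FiniteDimensional ℝ V] {B : V →ₗ[ℝ] Module.Dual ℝ V}
    (hB : ∀ x y, B x y = -B y x) {u v : V} (huv : B u v = 1) :
    Module.finrank ℝ (LinearMap.range B) = Module.finrank ℝ
      (LinearMap.range (B - ((-B v).smulRight (B u) - (B u).smulRight (-B v)))) + 2 := by
  have hvu : B v u = -1 := by rw [hB, huv]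
  have huu : B u u = 0 := by linarith [hB u u]
  have hvv : B v v = 0 := by linarith [hB v v]
  set B' := B - ((-B v).smulRight (B u) - (B u).smulRight (-B v)) with hB'
  have hB'a (x : V) : B' x = B x + B v x • B u - B u x • B v := by
    rw [hB']; simp; abel
  -- `B'` agrees with `B` on the orthogonal complement of the plane of `u`, `v` and vanishes on the
  -- plane, so the kernel grows by exactly this plane.
  have key : LinearMap.ker B' = LinearMap.ker B ⊔ Submodule.span ℝ (Set.range ![u, v]) := by
    apply le_antisymm
    · intro x hx
      have hx' : B x = -(B v x) • B u + B u x • B v := by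
        have := hB'a x
        rw [LinearMap.mem_ker.1 hx] at this
        rw [eq_comm, ← sub_eq_zero] at this
        rw [← sub_eq_zero, ← this]; module
      rw [Submodule.mem_sup]
      refine ⟨x + B v x • u - B u x • v, ?_, -(B v x) • u + B u x • v, ?_, by module⟩
      · rw [LinearMap.mem_ker]; simp only [map_add, map_sub, map_smul, hx']; module
      · refine add_mem ?_ ?_
        · exact Submodule.smul_mem _ _ (Submodule.subset_span ⟨0, rfl⟩)
        · exact Submodule.smul_mem _ _ (Submodule.subset_span ⟨1, rfl⟩)
    · refine sup_le ?_ ?_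
      · intro x hx
        rw [LinearMap.mem_ker] at hx ⊢
        rw [hB'a, hB v x, hB u x, hx]; simp
      · rw [Submodule.span_le]
        rintro _ ⟨i, rfl⟩
        fin_cases i
        · simp only [hB'a, huu, hvu, SetLike.mem_coe, LinearMap.mem_ker, Fin.zero_eta,
            Matrix.cons_val_zero]
          module
        · simp [hB'a, hvv, huv]
  have hcoef {a b : ℝ} (h : a • u + b • v ∈ LinearMap.ker B) : a = 0 ∧ b = 0 := by
    rw [LinearMap.mem_ker] at h
    have h1 := congrArg (· u) h
    have h2 := congrArg (· v) h
    simp [huu, hvv, huv, hvu] at h1 h2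
    exact ⟨h2, h1⟩
  have hli : LinearIndependent ℝ ![u, v] := by
    rw [LinearIndependent.pair_iff]
    intro a b h
    exact hcoef (by rw [h]; simp)
  have hdisj : LinearMap.ker B ⊓ Submodule.span ℝ (Set.range ![u, v]) = ⊥ := by
    rw [eq_bot_iff]
    rintro x ⟨hx, hx'⟩
    simp only [Matrix.range_cons, Matrix.range_empty, Set.union_empty, Set.singleton_union,
      SetLike.mem_coe, Submodule.mem_span_pair] at hx'
    obtain ⟨a, b, rfl⟩ := hx'
    obtain ⟨rfl, rfl⟩ := hcoef hx
    simp
  have h1 := Submodule.finrank_sup_add_finrank_inf_eq (LinearMap.ker B)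
    (Submodule.span ℝ (Set.range ![u, v]))
  rw [hdisj, ← key, finrank_span_eq_card hli] at h1
  have h2 := LinearMap.finrank_range_add_finrank_ker B
  have h3 := LinearMap.finrank_range_add_finrank_ker B'
  simp at h1
  omega

open CliffordAlgebra in
/-- The largest nonvanishing power of the 2-form of an alternating form is half the rank. -/
theorem twoFormOf_pow [FiniteDimensional ℝ V] (X : Module.Basis ι ℝ V) (n : ℕ)
    (B : V →ₗ[ℝ] Module.Dual ℝ V) (hB : ∀ x y, B x y = -B y x)
    (hn : Module.finrank ℝ (LinearMap.range B) = n) :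
    ∃ m, n = 2 * m ∧ twoFormOf X B ^ m ≠ 0 ∧ twoFormOf X B ^ (m + 1) = 0 := by
  induction n using Nat.strong_induction_on generalizing B with
  | _ n ih =>
  by_cases h0 : B = 0
  · subst h0
    refine ⟨0, ?_, by simp, by simp [twoFormOf]⟩
    rw [← hn, LinearMap.range_zero, finrank_bot]
  obtain ⟨u, v, huv⟩ : ∃ u v, B u v = 1 := by
    by_contra! hne
    apply h0
    ext u v
    by_contra hc
    apply hne ((B u v)⁻¹ • u) v
    simpa using inv_mul_cancel₀ hc
  have hvu : B v u = -1 := by rw [hB, huv]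
  have huu : B u u = 0 := by linarith [hB u u]
  have hvv : B v v = 0 := by linarith [hB v v]
  have hr := finrank_range_sub_hyperbolic hB huv
  -- The sign makes `α`, `β` dual to `u`, `v`: `α u = β v = 1` and `α v = β u = 0`.
  set α := -B v with hα
  set β := B u with hβ
  set B' := B - (α.smulRight β - β.smulRight α) with hB'
  have hB'a (x y : V) : B' x y = B x y - α x * β y + β x * α y := by
    rw [hB']; simp; ring
  have hskew (x y : V) : B' x y = -B' y x := by
    rw [hB'a, hB'a, hB x y]; ring
  have hu' : B' u = 0 := by
    ext y; rw [hB'a, huu]; simp [hα, hvu, ← hβ]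
  have hv' : B' v = 0 := by
    ext y; rw [hB'a, huv]; simp [hα, hvv]
  obtain ⟨m, hm, hne, hz⟩ := ih (n - 2) (by omega) B' hskew (by omega)
  have hw : twoFormOf X B =
      twoFormOf X B' + -(ExteriorAlgebra.ι ℝ α * ExteriorAlgebra.ι ℝ β) := by
    rw [← sub_eq_add_neg, ← twoFormOf_smulRight]
    congr 1
    ext x y
    simp [hB']
  set w' := twoFormOf X B'
  have hsw (a b : Module.Dual ℝ V) : ExteriorAlgebra.ι ℝ a * ExteriorAlgebra.ι ℝ b =
      -(ExteriorAlgebra.ι ℝ b * ExteriorAlgebra.ι ℝ a) := by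
    rw [eq_neg_iff_add_eq_zero]; exact ExteriorAlgebra.ι_add_mul_swap a b
  have hcomm2 (a b c : Module.Dual ℝ V) :
      Commute (ExteriorAlgebra.ι ℝ a * ExteriorAlgebra.ι ℝ b) (ExteriorAlgebra.ι ℝ c) := by
    rw [commute_iff_eq, mul_assoc, hsw b c, mul_neg, ← mul_assoc, hsw a c, neg_mul, neg_neg,
      mul_assoc]
  have hcomm : Commute w' (-(ExteriorAlgebra.ι ℝ α * ExteriorAlgebra.ι ℝ β)) := by
    refine Commute.neg_right (Commute.symm ?_)
    refine Commute.neg_right (Commute.smul_right ?_ _)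
    refine Commute.sum_right _ _ _ fun i _ => Commute.sum_right _ _ _ fun j _ =>
      Commute.smul_right ?_ _
    exact (hcomm2 α β _).mul_right (hcomm2 α β _)
  have hsq : -(ExteriorAlgebra.ι ℝ α * ExteriorAlgebra.ι ℝ β) *
      -(ExteriorAlgebra.ι ℝ α * ExteriorAlgebra.ι ℝ β) = 0 := by
    rw [neg_mul_neg, ← mul_assoc, (hcomm2 α β α).eq, ← mul_assoc, ExteriorAlgebra.ι_sq_zero]
    simp
  have hd (z : V) (hz : B' z = 0) (k : ℕ) :
      contractLeft (Module.Dual.eval ℝ V z) (w' ^ k) = 0 := by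
    induction k with
    | zero => rw [pow_zero]; exact contractLeft_one _ _
    | succ k ihk => rw [pow_succ', contractLeft_twoFormOf_mul X hskew hz, ihk, mul_zero]
  refine ⟨m + 1, by omega, ?_, ?_⟩
  -- The power is a nonzero multiple of `α ∧ β ∧ w' ^ m`. Contracting with `u` and then `v` removes
  -- `α` and `β` and annihilates the powers of `w'`, so its vanishing would give `w' ^ m = 0`.
  · rw [hw, add_pow_succ_of_sq_zero hcomm hsq, hz, zero_add]
    intro h
    rw [← Nat.cast_smul_eq_nsmul ℝ, smul_eq_zero_iff_right (by positivity), neg_mul,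
      neg_eq_zero] at h
    have h1 := congrArg (contractLeft (Module.Dual.eval ℝ V u)) h
    rw [ExteriorAlgebra.contractLeft_ι_mul_ι_mul, hd u hu', map_zero] at h1
    have e1 : Module.Dual.eval ℝ V u α = 1 := by simp [hα, hvu]
    have e2 : Module.Dual.eval ℝ V u β = 0 := huu
    have e3 : Module.Dual.eval ℝ V v β = 1 := huv
    rw [e1, e2, one_smul, zero_smul, mul_zero, sub_zero, add_zero] at h1
    have h2 := congrArg (contractLeft (Module.Dual.eval ℝ V v)) h1
    erw [contractLeft_ι_mul] at h2
    rw [hd v hv', map_zero, e3, one_smul, mul_zero, sub_zero] at h2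
    exact hne h2
  · rw [hw, add_pow_succ_of_sq_zero hcomm hsq, pow_succ, hz]
    simp

end AlternatingForms

/-! ### Analytic families: independence and rank at one point persist on a dense open set -/

section AnalyticDensity

/-- Identity theorem: a zero set with interior would be the whole space, which is connected. -/
theorem dense_ne_zero_of_analytic {E : Type*} [NormedAddCommGroup E] [NormedSpace ℝ E]
    {p : E → ℝ} (hp : ∀ x, AnalyticAt ℝ p x) {x₀ : E} (h : p x₀ ≠ 0) :
    Dense {x | p x ≠ 0} := by
  rw [← compl_compl {x | p x ≠ 0}, ← interior_eq_empty_iff_dense_compl,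
    Set.eq_empty_iff_forall_notMem]
  intro z hz
  have hz' : p =ᶠ[nhds z] fun _ => 0 := by
    filter_upwards [mem_interior_iff_mem_nhds.1 hz] with y hy
    simpa using hy
  exact h (AnalyticOnNhd.eqOn_of_preconnected_of_eventuallyEq (fun x _ => hp x)
    (fun x _ => analyticAt_const) isPreconnected_univ (Set.mem_univ z) hz' (Set.mem_univ x₀))

theorem linearIndependent_row_iff_rank {m n : Type*} [Fintype m] [Fintype n]
    (A : Matrix m n ℝ) : LinearIndependent ℝ A.row ↔ A.rank = Fintype.card m := by
  rw [linearIndependent_iff_card_eq_finrank_span, Matrix.rank_eq_finrank_span_row, eq_comm]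
  rfl

/-- Over the reals `A * Aᵀ` has the rank of `A`. The Gram determinant turns independence into the
nonvanishing of one analytic function, with no choice of a minor. -/
theorem linearIndependent_row_iff_det_gram {m n : Type*} [Fintype m] [Fintype n] [DecidableEq m]
    (A : Matrix m n ℝ) : LinearIndependent ℝ A.row ↔ (A * Aᵀ).det ≠ 0 := by
  rw [linearIndependent_row_iff_rank, ← Matrix.rank_self_mul_transpose,
    ← linearIndependent_row_iff_rank, Matrix.linearIndependent_rows_iff_isUnit,
    Matrix.isUnit_iff_isUnit_det, isUnit_iff_ne_zero]

/-- An analytic family of vectors that is linearly independent at one point is so on a dense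
open set. -/
theorem dense_linearIndependent_of_analytic {E κ σ : Type*} [NormedAddCommGroup E]
    [NormedSpace ℝ E] [Fintype κ] [Fintype σ] {v : κ → E → σ → ℝ}
    (hv : ∀ a j x, AnalyticAt ℝ (fun x => v a x j) x) {x₀ : E}
    (h : LinearIndependent ℝ fun a => v a x₀) :
    IsOpen {x | LinearIndependent ℝ fun a => v a x} ∧
      Dense {x | LinearIndependent ℝ fun a => v a x} := by
  classical
  let A (x : E) : Matrix κ σ ℝ := Matrix.of fun a j => v a x j
  have hA (x : E) : (LinearIndependent ℝ fun a => v a x) ↔ (A x * (A x)ᵀ).det ≠ 0 :=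
    linearIndependent_row_iff_det_gram (A x)
  have hp (x : E) : AnalyticAt ℝ (fun x => (A x * (A x)ᵀ).det) x := by
    simp only [Matrix.det_apply, Matrix.mul_apply, Matrix.transpose_apply, A, Matrix.of_apply]
    refine Finset.analyticAt_fun_sum _ fun τ _ => ?_
    refine AnalyticAt.const_smul ?_
    refine Finset.analyticAt_fun_prod _ fun a _ => ?_
    exact Finset.analyticAt_fun_sum _ fun j _ => (hv _ _ _).mul (hv _ _ _)
  simp only [hA] at h ⊢
  refine ⟨isOpen_ne_fun ?_ continuous_const, dense_ne_zero_of_analytic hp h⟩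
  exact continuous_iff_continuousAt.2 fun x => (hp x).continuousAt

/-- Rows that form a basis of the row space at `x₀` stay independent on a dense open set. -/
theorem dense_rank_ge_of_analytic {E m n : Type*} [NormedAddCommGroup E] [NormedSpace ℝ E]
    [Fintype m] [Fintype n] {A : E → Matrix m n ℝ}
    (hA : ∀ i j x, AnalyticAt ℝ (fun x => A x i j) x) (x₀ : E) :
    ∃ S : Set E, x₀ ∈ S ∧ IsOpen S ∧ Dense S ∧ ∀ x ∈ S, (A x₀).rank ≤ (A x).rank := by
  obtain ⟨κ, a, ha, hspan, hli⟩ := exists_linearIndependent' ℝ (A x₀).row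
  have : Finite κ := Finite.of_injective a ha
  have : Fintype κ := Fintype.ofFinite κ
  obtain ⟨h1, h2⟩ := dense_linearIndependent_of_analytic
    (v := fun c x => (A x).row (a c)) (fun c j x => hA (a c) j x) (x₀ := x₀) hli
  refine ⟨_, hli, h1, h2, fun x hx => ?_⟩
  rw [Matrix.rank_eq_finrank_span_row, ← hspan, finrank_span_eq_card hli,
    Matrix.rank_eq_finrank_span_row, ← finrank_span_eq_card (show LinearIndependent ℝ _ from hx)]
  refine Submodule.finrank_mono (Submodule.span_mono ?_)
  rintro _ ⟨c, rfl⟩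
  exact ⟨a c, rfl⟩

theorem linearIndependent_fderiv_iff {ι κ : Type*} [Fintype ι] [DecidableEq ι]
    (φ : κ → (ι → ℝ) →L[ℝ] ℝ) : LinearIndependent ℝ φ ↔
      LinearIndependent ℝ fun a => fun j => φ a (Pi.single j 1) := by
  let T : ((ι → ℝ) →L[ℝ] ℝ) →ₗ[ℝ] (ι → ℝ) :=
    { toFun := fun ψ j => ψ (Pi.single j 1)
      map_add' := fun _ _ => rfl
      map_smul' := fun _ _ => rfl }
  have hT : LinearMap.ker T = ⊥ := by
    rw [LinearMap.ker_eq_bot]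
    intro ψ χ h
    refine ContinuousLinearMap.coe_injective (LinearMap.pi_ext' fun j => ?_)
    ext
    exact congrFun h j
  exact (T.linearIndependent_iff hT).symm

end AnalyticDensity

/-! ### Generic corank, number of invariants and `j₀` -/

section GenericRank

variable {ι g : Type*} [LieRing g] [LieAlgebra ℝ g]

/-- The element of a Lie algebra with basis `X`, as a linear function on the dual space. -/
noncomputable def evalDual (X : Module.Basis ι ℝ g) : g →ₗ[ℝ] ((ι → ℝ) →L[ℝ] ℝ) :=
  X.constr ℝ fun k => ContinuousLinearMap.proj k

theorem evalDual_apply [Fintype ι] (X : Module.Basis ι ℝ g) (b : g) (x : ι → ℝ) :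
    evalDual X b x = ∑ k, X.repr b k * x k := by
  simp [evalDual, Module.Basis.constr_apply_fintype]

@[simp] theorem evalDual_basis (X : Module.Basis ι ℝ g) (i : ι) (x : ι → ℝ) :
    evalDual X (X i) x = x i := by
  rw [evalDual, Module.Basis.constr_basis]; rfl

/-- Evaluating at the coordinate vector of a linear form gives back the form. -/
theorem evalDual_of_dual [Fintype ι] (X : Module.Basis ι ℝ g) (φ : Module.Dual ℝ g) (b : g) :
    evalDual X b (fun i => φ (X i)) = φ b := by
  rw [evalDual_apply]
  conv_rhs => rw [← X.sum_repr b, map_sum]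
  simp only [map_smul, smul_eq_mul]

/-- The coadjoint action of `a` on the point `x` of the dual space. -/
noncomputable def coadjointVector (X : Module.Basis ι ℝ g) (a : g) (x : ι → ℝ) : ι → ℝ :=
  fun j => evalDual X ⁅a, X j⁆ x

theorem evalDual_coadjointVector [Fintype ι] (X : Module.Basis ι ℝ g) (a b : g) (x : ι → ℝ) :
    evalDual X b (coadjointVector X a x) = evalDual X ⁅a, b⁆ x := by
  rw [evalDual_apply]
  conv_rhs => rw [← X.sum_repr b, lie_sum, map_sum]
  simp only [coadjointVector, lie_smul, map_smul, sum_apply,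
    smul_apply, smul_eq_mul]

/-- The alternating form `(a, b) ↦ x ⁅a, b⁆` of a point `x` of the dual space. -/
noncomputable def kirillovForm (X : Module.Basis ι ℝ g) (x : ι → ℝ) :
    g →ₗ[ℝ] Module.Dual ℝ g :=
  LinearMap.mk₂ ℝ (fun a b => evalDual X ⁅a, b⁆ x) (by simp) (by simp) (by simp) (by simp)

@[simp] theorem kirillovForm_apply (X : Module.Basis ι ℝ g) (x : ι → ℝ) (a b : g) :
    kirillovForm X x a b = evalDual X ⁅a, b⁆ x := rfl

theorem kirillovForm_skew (X : Module.Basis ι ℝ g) (x : ι → ℝ) (a b : g) :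
    kirillovForm X x a b = -kirillovForm X x b a := by
  rw [kirillovForm_apply, kirillovForm_apply, ← lie_skew, map_neg]; rfl

theorem commutatorMatrix_apply [Fintype ι] (X : Module.Basis ι ℝ g) (x : ι → ℝ) (i j : ι) :
    commutatorMatrix X x i j = evalDual X ⁅X i, X j⁆ x := by
  rw [evalDual_apply]; rfl

theorem rank_commutatorMatrix [Fintype ι] (X : Module.Basis ι ℝ g) (x : ι → ℝ) :
    (commutatorMatrix X x).rank = Module.finrank ℝ (LinearMap.range (kirillovForm X x)) := by
  classical
  have h : (commutatorMatrix X x)ᵀ = LinearMap.toMatrix X X.dualBasis (kirillovForm X x) := by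
    ext i j
    rw [LinearMap.toMatrix_apply, Matrix.transpose_apply, commutatorMatrix_apply]
    simp
  rw [← Matrix.rank_transpose, h, Matrix.rank_eq_finrank_range_toLin _ X.dualBasis X,
    Matrix.toLin_toMatrix]

theorem analyticAt_commutatorMatrix [Fintype ι] (X : Module.Basis ι ℝ g) (i j : ι) (x : ι → ℝ) :
    AnalyticAt ℝ (fun x => commutatorMatrix X x i j) x := by
  simp only [commutatorMatrix_apply]
  exact (evalDual X ⁅X i, X j⁆).analyticAt x

theorem coadjointOperator_eq [Fintype ι] [DecidableEq ι] (X : Module.Basis ι ℝ g) (i : ι)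
    (F : (ι → ℝ) → ℝ) (x : ι → ℝ) :
    coadjointOperator X i F x = fderiv ℝ F x (coadjointVector X (X i) x) := by
  conv_rhs => rw [pi_eq_sum_univ' (coadjointVector X (X i) x), map_sum]
  rw [coadjointOperator]
  refine Finset.sum_congr rfl fun j _ => ?_
  rw [map_smul, coadjointVector, evalDual_apply, smul_eq_mul, Finset.sum_mul]
  rfl

/-- The differentials of invariants lie in the kernel of the commutator matrix. -/
theorem card_add_rank_le_of_invariants [Fintype ι] [DecidableEq ι] (X : Module.Basis ι ℝ g) {m : ℕ}
    {F : Fin m → (ι → ℝ) → ℝ} {x : ι → ℝ} (hF : ∀ a i, coadjointOperator X i (F a) x = 0)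
    (hli : LinearIndependent ℝ fun a => fderiv ℝ (F a) x) :
    m + (commutatorMatrix X x).rank ≤ Fintype.card ι := by
  rw [linearIndependent_fderiv_iff] at hli
  have hker (a : Fin m) : (fun j => fderiv ℝ (F a) x (Pi.single j 1)) ∈
      LinearMap.ker (commutatorMatrix X x).mulVecLin := by
    rw [LinearMap.mem_ker]
    ext i
    rw [Matrix.mulVecLin_apply, Pi.zero_apply, ← hF a i, coadjointOperator]
    simp only [Matrix.mulVec, dotProduct, commutatorMatrix, Matrix.of_apply, Finset.sum_mul]
  have h1 := Submodule.finrank_mono (Submodule.span_le.2 (Set.range_subset_iff.2 hker))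
  rw [finrank_span_eq_card hli, Fintype.card_fin] at h1
  have h2 := LinearMap.finrank_range_add_finrank_ker (commutatorMatrix X x).mulVecLin
  rw [Module.finrank_fintype_fun_eq_card] at h2
  rw [Matrix.rank]
  omega

/-- A vector `x` serves both as coefficients of the forms `dω_k` and as a point of the dual space;
this identifies the space they span with the set of 2-forms of Kirillov forms. -/
theorem maurerCartanForm_combination [Fintype ι] (X : Module.Basis ι ℝ g) (x : ι → ℝ) :
    ∑ k, x k • maurerCartanForm X k = twoFormOf X (kirillovForm X x) := by
  simp only [maurerCartanForm, twoFormOf, smul_neg, Finset.sum_neg_distrib]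
  congr 1
  simp only [kirillovForm_apply, evalDual_apply, Finset.smul_sum, smul_smul, Finset.sum_smul]
  rw [Finset.sum_comm]
  refine Finset.sum_congr rfl fun i _ => ?_
  rw [Finset.sum_comm]
  refine Finset.sum_congr rfl fun j _ => ?_
  refine Finset.sum_congr rfl fun k _ => ?_
  rw [structConst]
  congr 1
  ring

theorem mem_maurerCartanSpace_iff [Fintype ι] (X : Module.Basis ι ℝ g)
    (w : ExteriorAlgebra ℝ (Module.Dual ℝ g)) :
    w ∈ maurerCartanSpace X ↔ ∃ x, twoFormOf X (kirillovForm X x) = w := by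
  rw [maurerCartanSpace, Submodule.mem_span_range_iff_exists_fun]
  simp only [maurerCartanForm_combination]

theorem two_mul_formRank [Fintype ι] (X : Module.Basis ι ℝ g) (x : ι → ℝ) :
    2 * formRank (twoFormOf X (kirillovForm X x)) = (commutatorMatrix X x).rank := by
  have := Module.Finite.of_basis X
  obtain ⟨m, hm, hne, hz⟩ := twoFormOf_pow X _ _ (kirillovForm_skew X x) rfl
  rw [rank_commutatorMatrix, hm, formRank]
  congr 1
  -- The supremum is attained, so the default value of `sSup` on unbounded sets plays no role.
  refine IsGreatest.csSup_eq ⟨hne, fun k hk => ?_⟩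
  by_contra! hlt
  exact hk (pow_eq_zero_of_le hlt hz)

/-- If a Lie algebra has `k` analytic invariants with independent differentials at one point, and
the commutator matrix has corank at most `k` at one point, then `k` is the number of functionally
independent invariants on every open set, and both rank formulas hold. -/
theorem numInvariants_eq_of_invariants [Fintype ι] [DecidableEq ι] (X : Module.Basis ι ℝ g) {k : ℕ}
    {F : Fin k → (ι → ℝ) → ℝ} (hF : ∀ a x, AnalyticAt ℝ (F a) x)
    (hinv : ∀ a i x, coadjointOperator X i (F a) x = 0) {x₀ : ι → ℝ}
    (hli : LinearIndependent ℝ fun a => fderiv ℝ (F a) x₀)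
    (x₁ : ι → ℝ) (hrank : Fintype.card ι ≤ (commutatorMatrix X x₁).rank + k) :
    (∀ U : Set (ι → ℝ), IsOpen U → U.Nonempty →
      IsGreatest {m : ℕ | ∃ F : Fin m → (ι → ℝ) → ℝ,
        (∀ a, IsInvariantOn X U (F a)) ∧ FunctionallyIndependentOn U F} k) ∧
    numInvariants X = k ∧
    (numInvariants X : ℤ) = (Module.finrank ℝ g : ℤ) - 2 * (jZero X : ℤ) := by
  have hdense : Dense {x | LinearIndependent ℝ fun a => fderiv ℝ (F a) x} := by
    simp only [linearIndependent_fderiv_iff] at hli ⊢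
    refine (dense_linearIndependent_of_analytic
      (v := fun a x j => fderiv ℝ (F a) x (Pi.single j 1)) (fun a j x => ?_) hli).2
    exact ((ContinuousLinearMap.apply ℝ ℝ (Pi.single j 1 : ι → ℝ)).analyticAt _).comp
      (hF a x).fderiv
  -- The rank at `x` does not drop on an open set containing `x`, which meets the dense set where
  -- the differentials are independent. The bound therefore holds at every `x`, degenerate or not.
  have hle (x : ι → ℝ) : (commutatorMatrix X x).rank + k ≤ Fintype.card ι := by
    obtain ⟨S, hxS, hSo, -, hS⟩ := dense_rank_ge_of_analytic (analyticAt_commutatorMatrix X) x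
    obtain ⟨y, hyS, hy⟩ := hdense.inter_open_nonempty S hSo ⟨x, hxS⟩
    have := card_add_rank_le_of_invariants X (fun a i => hinv a i y) hy
    have := hS y hyS
    omega
  have hmax : (commutatorMatrix X x₁).rank + k = Fintype.card ι := le_antisymm (hle x₁) hrank
  have hsup : ⨆ x, (commutatorMatrix X x).rank = (commutatorMatrix X x₁).rank := by
    refine IsGreatest.csSup_eq ⟨⟨x₁, rfl⟩, ?_⟩
    rintro _ ⟨x, rfl⟩
    have := hle x
    dsimp only
    omega
  have hj : 2 * jZero X = (commutatorMatrix X x₁).rank := by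
    rw [← two_mul_formRank]
    congr 1
    refine IsGreatest.csSup_eq
      ⟨⟨⟨_, (mem_maurerCartanSpace_iff X _).2 ⟨x₁, rfl⟩⟩, rfl⟩, ?_⟩
    rintro _ ⟨⟨w, hw⟩, rfl⟩
    obtain ⟨x, rfl⟩ := (mem_maurerCartanSpace_iff X w).1 hw
    have h1 := two_mul_formRank X x
    have h2 := two_mul_formRank X x₁
    have := hle x
    dsimp only
    omega
  have hn : numInvariants X = k := by
    rw [numInvariants, hsup, Module.finrank_eq_card_basis X]
    omega
  refine ⟨fun U hU hne => ⟨⟨F, fun a => ⟨?_, fun i x _ => hinv a i x⟩, ?_⟩, ?_⟩, hn, ?_⟩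
  · exact (contDiff_iff_contDiffAt.2 fun x => (hF a x).contDiffAt).contDiffOn
  · exact hdense.open_subset_closure_inter hU
  · rintro m ⟨F', hF', hind⟩
    -- The rank is at least that at `x₁` on the dense open set `S`. Since `S` meets `U`, some point
    -- of `S` in `U` also has independent differentials of `F'`.
    obtain ⟨S, -, hSo, hSd, hS⟩ := dense_rank_ge_of_analytic (analyticAt_commutatorMatrix X) x₁
    obtain ⟨z, hzU, hzS⟩ := hSd.inter_open_nonempty U hU hne
    obtain ⟨y, hyS, hyU, hy⟩ := mem_closure_iff.1 (hind hzU) S hSo hzS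
    have := card_add_rank_le_of_invariants X (fun a i => (hF' a).2 i y hyU) hy
    have := hS y hyS
    omega
  · rw [hn, Module.finrank_eq_card_basis X]
    omega

end GenericRank

/-! ### Derivatives of traces of matrix powers -/

section TracePowers

variable {n : Type*} [Fintype n] [DecidableEq n]

/-- The derivative `D'` is a sum of terms `M ^ a * D * M ^ b`, which do not commute; cyclicity of
the trace makes them equal once paired with a power of `M`. The free exponent `p` is what the
induction consumes. -/
theorem hasDerivAt_pow_entry {M : ℝ → Matrix n n ℝ} {D : Matrix n n ℝ} {t : ℝ}
    (h : ∀ i j, HasDerivAt (fun s => M s i j) (D i j) t) (m : ℕ) :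
    ∃ D' : Matrix n n ℝ, (∀ i j, HasDerivAt (fun s => (M s ^ (m + 1)) i j) (D' i j) t) ∧
      ∀ p, (D' * M t ^ p).trace = (m + 1) * (M t ^ (m + p) * D).trace := by
  induction m with
  | zero =>
    refine ⟨D, by simpa using h, fun p => ?_⟩
    rw [Matrix.trace_mul_comm]; simp
  | succ m ih =>
    obtain ⟨D', hD', htr⟩ := ih
    refine ⟨D' * M t + M t ^ (m + 1) * D, fun i j => ?_, fun p => ?_⟩
    · simp only [pow_succ _ (m + 1), Matrix.mul_apply, Matrix.add_apply, ← Finset.sum_add_distrib]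
      exact HasDerivAt.fun_sum fun k _ => (hD' i k).mul (h k j)
    · rw [add_mul, Matrix.trace_add, mul_assoc D', ← pow_succ', htr, mul_assoc,
        Matrix.trace_mul_comm (M t ^ (m + 1)), mul_assoc, Matrix.trace_mul_comm D, ← pow_add,
        show p + (m + 1) = m + 1 + p by ring, show m + (p + 1) = m + 1 + p by ring]
      push_cast
      ring

theorem hasDerivAt_trace_pow {M : ℝ → Matrix n n ℝ} {D : Matrix n n ℝ} {t : ℝ}
    (h : ∀ i j, HasDerivAt (fun s => M s i j) (D i j) t) (m : ℕ) :
    HasDerivAt (fun s => (M s ^ (m + 1)).trace) ((m + 1) * (M t ^ m * D).trace) t := by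
  obtain ⟨D', hD', htr⟩ := hasDerivAt_pow_entry h m
  have := htr 0
  rw [pow_zero, mul_one, add_zero] at this
  rw [← this]
  exact HasDerivAt.fun_sum fun i _ => hD' i i

theorem analyticAt_trace_pow {E : Type*} [NormedAddCommGroup E] [NormedSpace ℝ E]
    {M : E → Matrix n n ℝ} {x : E} (h : ∀ i j, AnalyticAt ℝ (fun x => M x i j) x) (m : ℕ) :
    AnalyticAt ℝ (fun x => (M x ^ m).trace) x := by
  have key (i j : n) : AnalyticAt ℝ (fun x => (M x ^ m) i j) x := by
    induction m generalizing i j with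
    | zero => simpa using analyticAt_const
    | succ m ih =>
      simp only [pow_succ, Matrix.mul_apply]
      exact Finset.analyticAt_fun_sum _ fun k _ => (ih i k).mul (h k j)
  exact Finset.analyticAt_fun_sum _ fun i _ => key i i

end TracePowers

/-! ### The adjoint action on generators and the corrected matrix -/

namespace IHa

variable {N : ℕ}

section Sums

variable {κ : Type*} (s : Finset κ) (a : κ → IHa N)

theorem sum_J : (∑ k ∈ s, a k).J = ∑ k ∈ s, (a k).J :=
  map_sum (AddMonoidHom.mk' (IHa.J (N := N)) fun _ _ => rfl) a s
theorem sum_G : (∑ k ∈ s, a k).G = ∑ k ∈ s, (a k).G :=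
  map_sum (AddMonoidHom.mk' (IHa.G (N := N)) fun _ _ => rfl) a s
theorem sum_F : (∑ k ∈ s, a k).F = ∑ k ∈ s, (a k).F :=
  map_sum (AddMonoidHom.mk' (IHa.F (N := N)) fun _ _ => rfl) a s
theorem sum_Q : (∑ k ∈ s, a k).Q = ∑ k ∈ s, (a k).Q :=
  map_sum (AddMonoidHom.mk' (IHa.Q (N := N)) fun _ _ => rfl) a s
theorem sum_P : (∑ k ∈ s, a k).P = ∑ k ∈ s, (a k).P :=
  map_sum (AddMonoidHom.mk' (IHa.P (N := N)) fun _ _ => rfl) a s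
theorem sum_R : (∑ k ∈ s, a k).R = ∑ k ∈ s, (a k).R :=
  map_sum (AddMonoidHom.mk' (IHa.R (N := N)) fun _ _ => rfl) a s
theorem sum_E : (∑ k ∈ s, a k).E = ∑ k ∈ s, (a k).E :=
  map_sum (AddMonoidHom.mk' (IHa.E (N := N)) fun _ _ => rfl) a s
theorem sum_T : (∑ k ∈ s, a k).T = ∑ k ∈ s, (a k).T :=
  map_sum (AddMonoidHom.mk' (IHa.T (N := N)) fun _ _ => rfl) a s

end Sums

theorem J_skew (a : IHa N) (i j : Fin N) : a.J.1 i j = -a.J.1 j i := by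
  have h := congrFun (congrFun ((LieAlgebra.Orthogonal.mem_so (Fin N) ℝ a.J.1).1 a.J.2) j) i
  simpa using h

theorem lie_genG (a : IHa N) (i : Fin N) : ⁅a, genG i⁆ =
    ∑ k, a.J.1 k i • genG k - a.E • genP i - a.F i • genR - a.Q i • genT := by
  ext1
  all_goals simp [sum_J, sum_G, sum_F, sum_Q, sum_P, sum_R, sum_E, sum_T, genG, genP, genR, genT]
  ext l
  simp [Finset.sum_apply, Pi.single_apply]

theorem lie_genF (a : IHa N) (i : Fin N) : ⁅a, genF i⁆ =
    ∑ k, a.J.1 k i • genF k + a.E • genQ i + a.G i • genR - a.P i • genT := by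
  ext1
  all_goals simp [sum_J, sum_G, sum_F, sum_Q, sum_P, sum_R, sum_E, sum_T, genF, genQ, genR, genT]
  ext l
  simp [Finset.sum_apply, Pi.single_apply]

theorem lie_genQ (a : IHa N) (i : Fin N) : ⁅a, genQ i⁆ =
    ∑ k, a.J.1 k i • genQ k + a.G i • genT := by
  ext1
  all_goals simp [sum_J, sum_G, sum_F, sum_Q, sum_P, sum_R, sum_E, sum_T, genQ, genT]
  ext l
  simp [Finset.sum_apply, Pi.single_apply]

theorem lie_genP (a : IHa N) (i : Fin N) : ⁅a, genP i⁆ =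
    ∑ k, a.J.1 k i • genP k + a.F i • genT := by
  ext1
  all_goals simp [sum_J, sum_G, sum_F, sum_Q, sum_P, sum_R, sum_E, sum_T, genP, genT]
  ext l
  simp [Finset.sum_apply, Pi.single_apply]

theorem lie_genR (a : IHa N) : ⁅a, (genR : IHa N)⁆ = (2 * a.E) • genT := by
  ext1 <;> simp [genR, genT]

theorem lie_genT (a : IHa N) : ⁅a, (genT : IHa N)⁆ = 0 := by
  ext1 <;> simp [genT]

theorem neg_single_sub_mulVec (i j : Fin N) (v : Fin N → ℝ) :
    -((Matrix.single i j (1 : ℝ) - Matrix.single j i 1) *ᵥ v) =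
      v i • Pi.single j 1 - v j • Pi.single i 1 := by
  ext l
  simp [Matrix.sub_mulVec, Matrix.single_mulVec, Pi.single_apply, Function.update_apply]

theorem lie_genJ (a : IHa N) (i j : Fin N) : ⁅a, genJ i j⁆ =
    ∑ k, (a.J.1 k i • genJ k j + a.J.1 k j • genJ i k) +
      (a.G i • genG j - a.G j • genG i) + (a.F i • genF j - a.F j • genF i) +
      (a.Q i • genQ j - a.Q j • genQ i) + (a.P i • genP j - a.P j • genP i) := by
  ext1
  case J =>
    simp [sum_J, genG, genF, genQ, genP]
    apply Subtype.ext
    have hL : (⁅a.J, (genJ i j).J⁆ : LieAlgebra.Orthogonal.so (Fin N) ℝ).1 =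
      a.J.1 * (Matrix.single i j 1 - Matrix.single j i 1) -
        (Matrix.single i j 1 - Matrix.single j i 1) * a.J.1 := rfl
    rw [hL]
    ext l m
    simp only [AddSubmonoidClass.coe_finsetSum, Matrix.sum_apply]
    have hterm (c : Fin N) : (a.J.1 c i • (genJ c j).J + a.J.1 c j • (genJ i c).J).1 l m =
        a.J.1 c i * (Matrix.single c j (1 : ℝ) - Matrix.single j c 1 : Matrix (Fin N) (Fin N) ℝ) l m +
          a.J.1 c j * (Matrix.single i c (1 : ℝ) - Matrix.single c i 1 : Matrix (Fin N) (Fin N) ℝ) l m := rfl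
    simp only [hterm, Matrix.sub_apply, Matrix.mul_apply, Matrix.single_apply, mul_sub, sub_mul,
      Finset.sum_add_distrib, Finset.sum_sub_distrib, mul_ite, ite_mul, mul_one, one_mul,
      mul_zero, zero_mul, ite_and, Finset.sum_ite_irrel, Finset.sum_const_zero,
      Finset.sum_ite_eq, Finset.sum_ite_eq', Finset.mem_univ, if_true]
    rw [J_skew a i m, J_skew a j m]
    split_ifs <;> ring
  all_goals
    simp [sum_G, sum_F, sum_Q, sum_P, sum_R, sum_E, sum_T, genJ, genG, genF, genQ, genP]
  all_goals exact neg_single_sub_mulVec i j _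

variable {ι : Type*}

/-- The matrix of the generators of the orthogonal algebra, corrected so as to commute with the
generators of the radical and cleared of denominators. -/
noncomputable def coMatrix (X : Module.Basis ι ℝ (IHa N)) (x : ι → ℝ) :
    Matrix (Fin N) (Fin N) ℝ :=
  Matrix.of fun i j =>
    evalDual X genT x ^ 2 * evalDual X (genJ i j) x +
    evalDual X genT x *
      (evalDual X (genG i) x * evalDual X (genQ j) x -
        evalDual X (genQ i) x * evalDual X (genG j) x +
        (evalDual X (genF i) x * evalDual X (genP j) x -
        evalDual X (genP i) x * evalDual X (genF j) x)) +
    evalDual X genR x *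
      (evalDual X (genP i) x * evalDual X (genQ j) x -
        evalDual X (genQ i) x * evalDual X (genP j) x)

/-- The derivative of `coMatrix` at `x` in the direction `v`. -/
noncomputable def coMatrixDeriv (X : Module.Basis ι ℝ (IHa N)) (x v : ι → ℝ) :
    Matrix (Fin N) (Fin N) ℝ :=
  Matrix.of fun i j =>
    (2 * evalDual X genT x * evalDual X genT v * evalDual X (genJ i j) x +
      evalDual X genT x ^ 2 * evalDual X (genJ i j) v) +
    (evalDual X genT v *
      (evalDual X (genG i) x * evalDual X (genQ j) x -
        evalDual X (genQ i) x * evalDual X (genG j) x +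
        (evalDual X (genF i) x * evalDual X (genP j) x -
        evalDual X (genP i) x * evalDual X (genF j) x)) +
    evalDual X genT x *
      (evalDual X (genG i) v * evalDual X (genQ j) x +
        evalDual X (genG i) x * evalDual X (genQ j) v -
        (evalDual X (genQ i) v * evalDual X (genG j) x +
        evalDual X (genQ i) x * evalDual X (genG j) v) +
        (evalDual X (genF i) v * evalDual X (genP j) x +
        evalDual X (genF i) x * evalDual X (genP j) v -
        (evalDual X (genP i) v * evalDual X (genF j) x +
        evalDual X (genP i) x * evalDual X (genF j) v)))) +
    (evalDual X genR v *
      (evalDual X (genP i) x * evalDual X (genQ j) x -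
        evalDual X (genQ i) x * evalDual X (genP j) x) +
    evalDual X genR x *
      (evalDual X (genP i) v * evalDual X (genQ j) x +
        evalDual X (genP i) x * evalDual X (genQ j) v -
        (evalDual X (genQ i) v * evalDual X (genP j) x +
        evalDual X (genQ i) x * evalDual X (genP j) v)))

theorem hasDerivAt_coMatrix (X : Module.Basis ι ℝ (IHa N)) (x v : ι → ℝ) (i j : Fin N) :
    HasDerivAt (fun s : ℝ => coMatrix X (x + s • v) i j) (coMatrixDeriv X x v i j) 0 := by
  have h (b : IHa N) : HasDerivAt (fun s : ℝ => evalDual X b (x + s • v)) (evalDual X b v) 0 := by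
    simpa using ((hasDerivAt_id (0 : ℝ)).mul_const (evalDual X b v)).const_add (evalDual X b x)
  have hT := h genT
  have hR := h genR
  have hJ := h (genJ i j)
  have hV (V V' : Fin N → IHa N) := ((h (V i)).mul (h (V' j))).sub ((h (V' i)).mul (h (V j)))
  exact ((((hT.pow 2).mul hJ).add (hT.mul ((hV genG genQ).add (hV genF genP)))).add
    (hR.mul (hV genP genQ))).congr_deriv (by simp [coMatrixDeriv])

theorem analyticAt_coMatrix [Fintype ι] (X : Module.Basis ι ℝ (IHa N)) (x : ι → ℝ) (i j : Fin N) :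
    AnalyticAt ℝ (fun x => coMatrix X x i j) x := by
  have h (b : IHa N) : AnalyticAt ℝ (fun x => evalDual X b x) x := (evalDual X b).analyticAt x
  have hV (V V' : Fin N → IHa N) := ((h (V i)).mul (h (V' j))).sub ((h (V' i)).mul (h (V j)))
  exact ((((h genT).pow 2).mul (h (genJ i j))).add
    ((h genT).mul ((hV genG genQ).add (hV genF genP)))).add ((h genR).mul (hV genP genQ))

/-- The contributions of the radical cancel. For a `G`-component, the shift of `T² J` is undone by
that of `Q` in the `T`-terms, while the multiple of `R` coming from `⁅G, F⁆` is undone by the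
`R`-term; `F` is similar. For `E`, the shifts of `G` and `F` balance `⁅E, R⁆ = 2T`. Only rotations
act, by a commutator. -/
theorem coMatrixDeriv_coadjointVector [Fintype ι] (X : Module.Basis ι ℝ (IHa N)) (a : IHa N) (x : ι → ℝ) :
    coMatrixDeriv X x (coadjointVector X a x) = coMatrix X x * a.J.1 - a.J.1 * coMatrix X x := by
  ext i j
  have h1 : (coMatrix X x * a.J.1) i j =
      evalDual X genT x ^ 2 * ∑ k, a.J.1 k j * evalDual X (genJ i k) x +
      evalDual X genT x *
        (evalDual X (genG i) x * (∑ k, a.J.1 k j * evalDual X (genQ k) x) -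
          evalDual X (genQ i) x * (∑ k, a.J.1 k j * evalDual X (genG k) x) +
          (evalDual X (genF i) x * (∑ k, a.J.1 k j * evalDual X (genP k) x) -
          evalDual X (genP i) x * (∑ k, a.J.1 k j * evalDual X (genF k) x))) +
      evalDual X genR x *
        (evalDual X (genP i) x * (∑ k, a.J.1 k j * evalDual X (genQ k) x) -
          evalDual X (genQ i) x * (∑ k, a.J.1 k j * evalDual X (genP k) x)) := by
    simp only [Matrix.mul_apply, Finset.mul_sum, ← Finset.sum_add_distrib,
      ← Finset.sum_sub_distrib, coMatrix, Matrix.of_apply]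
    exact Finset.sum_congr rfl fun k _ => by ring
  have h2 : (a.J.1 * coMatrix X x) i j =
      -(evalDual X genT x ^ 2 * (∑ k, a.J.1 k i * evalDual X (genJ k j) x) +
      evalDual X genT x *
        ((∑ k, a.J.1 k i * evalDual X (genG k) x) * evalDual X (genQ j) x -
          (∑ k, a.J.1 k i * evalDual X (genQ k) x) * evalDual X (genG j) x +
          ((∑ k, a.J.1 k i * evalDual X (genF k) x) * evalDual X (genP j) x -
          (∑ k, a.J.1 k i * evalDual X (genP k) x) * evalDual X (genF j) x)) +
      evalDual X genR x *
        ((∑ k, a.J.1 k i * evalDual X (genP k) x) * evalDual X (genQ j) x -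
          (∑ k, a.J.1 k i * evalDual X (genQ k) x) * evalDual X (genP j) x)) := by
    simp only [Matrix.mul_apply, Finset.mul_sum, Finset.sum_mul, ← Finset.sum_add_distrib,
      ← Finset.sum_sub_distrib, ← Finset.sum_neg_distrib, coMatrix, Matrix.of_apply]
    exact Finset.sum_congr rfl fun k _ => by rw [J_skew a i k]; ring
  rw [Matrix.sub_apply, h1, h2]
  simp only [coMatrixDeriv, Matrix.of_apply, evalDual_coadjointVector, lie_genG, lie_genF,
    lie_genQ, lie_genP, lie_genR, lie_genT, lie_genJ, map_add, map_sub, map_sum, map_smul,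
    map_zero, zero_apply, add_apply, sub_apply, sum_apply, smul_apply, smul_eq_mul,
    Finset.sum_add_distrib]
  ring

end IHa

/-! ### A regular element of the orthogonal algebra -/

section RegularElement

variable {N : ℕ}

/-- The involution of the index set that exchanges `2 l` and `2 l + 1`. -/
def pairSwap (i : Fin N) : Fin N :=
  if i.1 % 2 = 0 then (if h : i.1 + 1 < N then ⟨i.1 + 1, h⟩ else i) else ⟨i.1 - 1, by omega⟩

theorem pairSwap_val (i : Fin N) : (pairSwap i).1 =
    if i.1 % 2 = 0 then (if i.1 + 1 < N then i.1 + 1 else i.1) else i.1 - 1 := by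
  unfold pairSwap; split_ifs <;> rfl

@[simp] theorem pairSwap_pairSwap (i : Fin N) : pairSwap (pairSwap i) = i := by
  apply Fin.ext
  rw [pairSwap_val, pairSwap_val]
  split_ifs <;> omega

/-- The rotation frequency of the plane containing the `i`-th axis. -/
def pairFreq (i : Fin N) : ℕ := if pairSwap i = i then 0 else i.1 / 2 + 1

theorem pairFreq_pairSwap (i : Fin N) : pairFreq (pairSwap i) = pairFreq i := by
  unfold pairFreq
  rw [pairSwap_pairSwap]
  simp only [Fin.ext_iff, pairSwap_val]
  split_ifs <;> omega

/-- Paired axes have frequency at least 1, so frequency 0 singles out the unpaired last axis of an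
odd `N`. -/
theorem eq_or_eq_pairSwap_of_pairFreq {i j : Fin N} (h : pairFreq i = pairFreq j) :
    j = i ∨ j = pairSwap i := by
  unfold pairFreq at h
  simp only [Fin.ext_iff, pairSwap_val] at h ⊢
  split_ifs at h ⊢ <;> omega

/-- The frequency with a sign that depends on the parity of the axis. -/
noncomputable def pairCoef (i : Fin N) : ℝ := if i.1 % 2 = 0 then pairFreq i else -pairFreq i

theorem pairCoef_pairSwap (i : Fin N) : pairCoef (pairSwap i) = -pairCoef i := by
  by_cases h : pairSwap i = i
  · have : pairFreq i = 0 := by simp [pairFreq, h]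
    simp [pairCoef, pairFreq_pairSwap, this]
  · have h' : ((pairSwap i).1 % 2 = 0) ↔ ¬ (i.1 % 2 = 0) := by
      rw [Fin.ext_iff] at h
      rw [pairSwap_val] at h ⊢
      split_ifs at h ⊢ <;> omega
    unfold pairCoef
    rw [pairFreq_pairSwap]
    by_cases h2 : i.1 % 2 = 0
    · rw [if_neg (by tauto), if_pos h2]
    · rw [if_pos (by tauto), if_neg h2, neg_neg]

theorem pairCoef_sq (i : Fin N) : pairCoef i ^ 2 = (pairFreq i : ℝ) ^ 2 := by
  unfold pairCoef; split_ifs <;> ring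

/-- The skew-symmetric matrix that rotates the planes of the axes `2 l` and `2 l + 1` with
distinct frequencies. -/
noncomputable def rotationMatrix (N : ℕ) : Matrix (Fin N) (Fin N) ℝ :=
  Matrix.of fun i j => if j = pairSwap i then pairCoef i else 0

theorem rotationMatrix_skew (i j : Fin N) : rotationMatrix N i j = -rotationMatrix N j i := by
  have h : i = pairSwap j ↔ j = pairSwap i :=
    ⟨fun h => by rw [h, pairSwap_pairSwap], fun h => by rw [h, pairSwap_pairSwap]⟩
  simp only [rotationMatrix, Matrix.of_apply, h]
  split_ifs with hj
  · rw [hj, pairCoef_pairSwap, neg_neg]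
  · simp

theorem rotationMatrix_sq :
    rotationMatrix N ^ 2 = Matrix.diagonal fun i => -(pairFreq i : ℝ) ^ 2 := by
  ext i j
  rw [pow_two, Matrix.mul_apply, Matrix.diagonal_apply]
  simp only [rotationMatrix, Matrix.of_apply, ite_mul, zero_mul, Finset.sum_ite_eq',
    Finset.mem_univ, if_true, pairSwap_pairSwap]
  by_cases h : j = i
  · simp only [h, if_true, pairCoef_pairSwap, ← pairCoef_sq]
    ring
  · simp [h, Ne.symm h]

theorem rotationMatrix_pow_odd (k : ℕ) (i j : Fin N) :
    (rotationMatrix N ^ (2 * k + 1)) i j =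
      (-(pairFreq i : ℝ) ^ 2) ^ k * rotationMatrix N i j := by
  rw [pow_succ, pow_mul, rotationMatrix_sq, Matrix.diagonal_pow, Matrix.diagonal_mul]
  rfl

/-- The centralizer of `rotationMatrix N` consists of block diagonal matrices. -/
theorem apply_eq_zero_of_commute_rotationMatrix {A : Matrix (Fin N) (Fin N) ℝ}
    (h : Commute A (rotationMatrix N)) {i j : Fin N} (hi : j ≠ i) (hs : j ≠ pairSwap i) :
    A i j = 0 := by
  have h2 := congrFun (congrFun (h.pow_right 2).eq i) j
  rw [rotationMatrix_sq, Matrix.mul_diagonal, Matrix.diagonal_mul] at h2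
  -- The square of the rotation is diagonal, and its eigenvalues separate the planes.
  have hne : (pairFreq i : ℝ) ^ 2 - (pairFreq j : ℝ) ^ 2 ≠ 0 := by
    intro h0
    rcases eq_or_eq_pairSwap_of_pairFreq (i := i) (j := j) (by
      have h1 : (pairFreq i) ^ 2 = (pairFreq j) ^ 2 := by
        exact_mod_cast sub_eq_zero.1 h0
      exact Nat.pow_left_injective two_ne_zero h1) with h1 | h1
    · exact hi h1
    · exact hs h1
  have h3 : ((pairFreq i : ℝ) ^ 2 - (pairFreq j : ℝ) ^ 2) * A i j = 0 := by linarith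
  exact (mul_eq_zero.1 h3).resolve_left hne

/-- The first axis of the `l`-th rotation plane. -/
def planeFst (l : Fin (N / 2)) : Fin N := ⟨2 * l.1, by omega⟩

theorem pairFreq_planeFst (l : Fin (N / 2)) : pairFreq (planeFst l) = l.1 + 1 := by
  unfold pairFreq
  simp only [Fin.ext_iff, pairSwap_val, planeFst]
  split_ifs <;> omega

theorem pairCoef_planeFst (l : Fin (N / 2)) : pairCoef (planeFst l) = l.1 + 1 := by
  rw [pairCoef, pairFreq_planeFst, if_pos (by simp [planeFst])]
  simp

/-- A skew matrix in the centralizer is block diagonal, and each skew block of size 2 has one free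
entry: one parameter for each plane. -/
theorem eq_zero_of_commute_rotationMatrix {A : Matrix (Fin N) (Fin N) ℝ}
    (h : Commute A (rotationMatrix N)) (hA : ∀ i j, A i j = -A j i)
    (h0 : ∀ l, A (planeFst l) (pairSwap (planeFst l)) = 0) : A = 0 := by
  have hd (i : Fin N) : A i i = 0 := by linarith [hA i i]
  ext i j
  by_cases hi : j = i
  · rw [hi]; exact hd i
  by_cases hs : j = pairSwap i
  swap
  · exact apply_eq_zero_of_commute_rotationMatrix h hi hs
  subst hs
  rw [Fin.ext_iff, pairSwap_val] at hi
  by_cases hpar : i.1 % 2 = 0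
  · have hl : i.1 / 2 < N / 2 := by split_ifs at hi <;> omega
    have e : i = planeFst ⟨i.1 / 2, hl⟩ := Fin.ext (by simp only [planeFst]; omega)
    rw [e]
    exact h0 _
  · have hl : i.1 / 2 < N / 2 := by omega
    have e : pairSwap i = planeFst ⟨i.1 / 2, hl⟩ := by
      apply Fin.ext
      rw [pairSwap_val, if_neg hpar]
      simp only [planeFst]
      omega
    have := h0 ⟨i.1 / 2, hl⟩
    rw [← e, pairSwap_pairSwap] at this
    rw [hA, this]
    simp

end RegularElement

/-! ### Corank and trace invariants at the regular point -/

namespace IHa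

variable {N : ℕ} {ι : Type*}

/-- The linear form with components `c` along `T` and `Y` along the orthogonal algebra. -/
noncomputable def orthogonalDual (c : ℝ) (Y : Matrix (Fin N) (Fin N) ℝ) :
    Module.Dual ℝ (IHa N) where
  toFun a := c * a.T + (1 / 2 : ℝ) * ∑ i, ∑ j, Y i j * a.J.1 i j
  map_add' a b := by
    have (i j : Fin N) : (a + b).J.1 i j = a.J.1 i j + b.J.1 i j := rfl
    simp only [add_T, this, mul_add, Finset.sum_add_distrib]
    ring
  map_smul' r a := by
    have (i j : Fin N) : (r • a).J.1 i j = r * a.J.1 i j := rfl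
    simp only [smul_T, this, smul_eq_mul, RingHom.id_apply, Finset.mul_sum, mul_add]
    congr 1
    · ring
    · exact Finset.sum_congr rfl fun i _ => Finset.sum_congr rfl fun j _ => by ring

theorem orthogonalDual_apply (c : ℝ) (Y : Matrix (Fin N) (Fin N) ℝ) (a : IHa N) :
    orthogonalDual c Y a = c * a.T + (1 / 2 : ℝ) * ∑ i, ∑ j, Y i j * a.J.1 i j := rfl

theorem orthogonalDual_of_J_eq_zero (c : ℝ) (Y : Matrix (Fin N) (Fin N) ℝ) {a : IHa N}
    (ha : a.J = 0) : orthogonalDual c Y a = c * a.T := by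
  rw [orthogonalDual_apply, ha]; simp

/-- The sum meets `J_ij` at `(i, j)` and at `(j, i)`; for skew `Y` the two terms are equal, which
explains the factor `1/2`. -/
theorem orthogonalDual_genJ (c : ℝ) {Y : Matrix (Fin N) (Fin N) ℝ} (hY : ∀ i j, Y i j = -Y j i)
    (i j : Fin N) : orthogonalDual c Y (genJ i j) = Y i j := by
  have h (k l : Fin N) : (genJ i j).J.1 k l =
      (Matrix.single i j (1 : ℝ) - Matrix.single j i 1 : Matrix (Fin N) (Fin N) ℝ) k l := rfl
  rw [orthogonalDual_apply]
  simp only [h, Matrix.sub_apply, Matrix.single_apply, mul_sub, Finset.sum_sub_distrib, ite_and,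
    mul_ite, mul_one, mul_zero, Finset.sum_ite_irrel, Finset.sum_const_zero, Finset.sum_ite_eq,
    Finset.mem_univ, if_true]
  rw [hY j i]
  simp only [genJ]
  ring

/-- The point of the dual space given by `orthogonalDual c Y`. -/
noncomputable def orthogonalPoint (X : Module.Basis ι ℝ (IHa N)) (c : ℝ)
    (Y : Matrix (Fin N) (Fin N) ℝ) : ι → ℝ :=
  fun i => orthogonalDual c Y (X i)

section OrthogonalPoint

variable [Fintype ι] (X : Module.Basis ι ℝ (IHa N)) (c : ℝ) (Y : Matrix (Fin N) (Fin N) ℝ)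

theorem evalDual_orthogonalPoint (b : IHa N) :
    evalDual X b (orthogonalPoint X c Y) = orthogonalDual c Y b :=
  evalDual_of_dual X _ b

theorem evalDual_genG_orthogonalPoint (i : Fin N) :
    evalDual X (genG i) (orthogonalPoint X c Y) = 0 := by
  rw [evalDual_orthogonalPoint, orthogonalDual_of_J_eq_zero _ _ rfl]; simp [genG]
theorem evalDual_genF_orthogonalPoint (i : Fin N) :
    evalDual X (genF i) (orthogonalPoint X c Y) = 0 := by
  rw [evalDual_orthogonalPoint, orthogonalDual_of_J_eq_zero _ _ rfl]; simp [genF]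
theorem evalDual_genQ_orthogonalPoint (i : Fin N) :
    evalDual X (genQ i) (orthogonalPoint X c Y) = 0 := by
  rw [evalDual_orthogonalPoint, orthogonalDual_of_J_eq_zero _ _ rfl]; simp [genQ]
theorem evalDual_genP_orthogonalPoint (i : Fin N) :
    evalDual X (genP i) (orthogonalPoint X c Y) = 0 := by
  rw [evalDual_orthogonalPoint, orthogonalDual_of_J_eq_zero _ _ rfl]; simp [genP]
theorem evalDual_genR_orthogonalPoint :
    evalDual X genR (orthogonalPoint X c Y) = 0 := by
  rw [evalDual_orthogonalPoint, orthogonalDual_of_J_eq_zero _ _ rfl]; simp [genR]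
theorem evalDual_genT_orthogonalPoint :
    evalDual X genT (orthogonalPoint X c Y) = c := by
  rw [evalDual_orthogonalPoint, orthogonalDual_of_J_eq_zero _ _ rfl]; simp [genT]
theorem evalDual_genJ_orthogonalPoint (hY : ∀ i j, Y i j = -Y j i) (i j : Fin N) :
    evalDual X (genJ i j) (orthogonalPoint X c Y) = Y i j := by
  rw [evalDual_orthogonalPoint, orthogonalDual_genJ c hY]

end OrthogonalPoint

variable [Fintype ι] (X : Module.Basis ι ℝ (IHa N))

theorem coMatrix_orthogonalPoint {Y : Matrix (Fin N) (Fin N) ℝ} (hY : ∀ i j, Y i j = -Y j i) :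
    coMatrix X (orthogonalPoint X 1 Y) = Y := by
  ext i j
  rw [coMatrix, Matrix.of_apply]
  simp only [evalDual_genT_orthogonalPoint, evalDual_genR_orthogonalPoint,
    evalDual_genG_orthogonalPoint, evalDual_genF_orthogonalPoint,
    evalDual_genJ_orthogonalPoint X _ _ hY]
  ring

theorem coMatrixDeriv_orthogonalPoint {Y Z : Matrix (Fin N) (Fin N) ℝ}
    (hY : ∀ i j, Y i j = -Y j i) (hZ : ∀ i j, Z i j = -Z j i) :
    coMatrixDeriv X (orthogonalPoint X 1 Y) (orthogonalPoint X 0 Z) = Z := by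
  ext i j
  rw [coMatrixDeriv, Matrix.of_apply]
  simp only [evalDual_genT_orthogonalPoint, evalDual_genR_orthogonalPoint,
    evalDual_genG_orthogonalPoint, evalDual_genF_orthogonalPoint, evalDual_genQ_orthogonalPoint,
    evalDual_genP_orthogonalPoint, evalDual_genJ_orthogonalPoint X _ _ hY,
    evalDual_genJ_orthogonalPoint X _ _ hZ]
  ring

/-- The element of the dual space at which all computations are made. -/
noncomputable def regularPoint : ι → ℝ := orthogonalPoint X 1 (rotationMatrix N)

/-- Since `T` has value 1, testing against `Q, P, G, F, R, E` kills the components `G, F, Q, P, E,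
R` in turn. Testing against `J_ij` then says that `a.J` commutes with the rotation. -/
theorem eq_zero_of_kirillovForm_regularPoint {a : IHa N}
    (ha : kirillovForm X (regularPoint X) a = 0)
    (hJ : ∀ l, a.J.1 (planeFst l) (pairSwap (planeFst l)) = 0) (hT : a.T = 0) : a = 0 := by
  have h (b : IHa N) : evalDual X ⁅a, b⁆ (regularPoint X) = 0 := by
    rw [← kirillovForm_apply, ha]; rfl
  have hG (i : Fin N) : a.G i = 0 := by
    simpa [lie_genQ, regularPoint, evalDual_genT_orthogonalPoint,
      evalDual_genQ_orthogonalPoint] using h (genQ i)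
  have hF (i : Fin N) : a.F i = 0 := by
    simpa [lie_genP, regularPoint, evalDual_genT_orthogonalPoint,
      evalDual_genP_orthogonalPoint] using h (genP i)
  have hQ (i : Fin N) : a.Q i = 0 := by
    simpa [lie_genG, regularPoint, evalDual_genT_orthogonalPoint, evalDual_genR_orthogonalPoint,
      evalDual_genP_orthogonalPoint, evalDual_genG_orthogonalPoint] using h (genG i)
  have hP (i : Fin N) : a.P i = 0 := by
    simpa [lie_genF, regularPoint, evalDual_genT_orthogonalPoint, evalDual_genR_orthogonalPoint,
      evalDual_genQ_orthogonalPoint, evalDual_genF_orthogonalPoint] using h (genF i)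
  have hE : a.E = 0 := by
    simpa [lie_genR, regularPoint, evalDual_genT_orthogonalPoint] using h genR
  have hR : a.R = 0 := by
    have := h genE
    rw [regularPoint, evalDual_orthogonalPoint, orthogonalDual_of_J_eq_zero] at this
    · simpa [genE] using this
    · simp [genE]
  have hcomm : Commute a.J.1 (rotationMatrix N) := by
    rw [commute_iff_eq]
    ext i j
    have := h (genJ i j)
    simp only [lie_genJ, hG, hF, hQ, hP, zero_smul, sub_zero, add_zero, map_sum, map_add,
      map_smul, sum_apply, add_apply, smul_apply, smul_eq_mul, regularPoint,
      evalDual_genJ_orthogonalPoint X _ _ rotationMatrix_skew, Finset.sum_add_distrib] at this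
    rw [Matrix.mul_apply, Matrix.mul_apply, ← sub_eq_zero, ← neg_eq_zero, ← this, neg_sub,
      sub_eq_add_neg, add_comm, ← Finset.sum_neg_distrib]
    congr 1
    · exact Finset.sum_congr rfl fun k _ => by rw [J_skew a i k, neg_mul, neg_neg]
    · exact Finset.sum_congr rfl fun k _ => mul_comm _ _
  ext1
  · exact Subtype.ext (eq_zero_of_commute_rotationMatrix hcomm (J_skew a) hJ)
  all_goals first | assumption | (ext i; simp only [hG, hF, hQ, hP]; rfl)

theorem card_le_rank_regularPoint :
    Fintype.card ι ≤ (commutatorMatrix X (regularPoint X)).rank + (N / 2 + 1) := by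
  have := Module.Finite.of_basis X
  let π : IHa N →ₗ[ℝ] (Fin (N / 2) → ℝ) × ℝ :=
    { toFun := fun a => (fun l => a.J.1 (planeFst l) (pairSwap (planeFst l)), a.T)
      map_add' := fun _ _ => rfl
      map_smul' := fun _ _ => rfl }
  have hinj : Function.Injective
      (π.domRestrict (LinearMap.ker (kirillovForm X (regularPoint X)))) := by
    rw [injective_iff_map_eq_zero]
    rintro ⟨a, ha⟩ h
    have h' : π a = 0 := h
    refine Subtype.ext (eq_zero_of_kirillovForm_regularPoint X ha (fun l => ?_) ?_)
    · exact congrFun (congrArg Prod.fst h') l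
    · exact congrArg Prod.snd h'
  have h1 := LinearMap.finrank_le_finrank_of_injective hinj
  have h2 := LinearMap.finrank_range_add_finrank_ker (kirillovForm X (regularPoint X))
  rw [Module.finrank_prod, Module.finrank_fintype_fun_eq_card, Fintype.card_fin,
    Module.finrank_self] at h1
  rw [Module.finrank_eq_card_basis X] at h2
  rw [rank_commutatorMatrix]
  omega

/-- The central generator and the traces of the even powers of `coMatrix`. -/
noncomputable def traceInvariants : Fin (N / 2 + 1) → (ι → ℝ) → ℝ :=
  -- The matrix is skew, so its odd powers are traceless. The exponents are `2, 4, …, 2[N/2]`,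
  -- written as successors for the derivative formula.
  Fin.cons (evalDual X genT) fun k x => (coMatrix X x ^ (2 * k.1 + 1 + 1)).trace

theorem analyticAt_traceInvariants (k : Fin (N / 2 + 1)) (x : ι → ℝ) :
    AnalyticAt ℝ (traceInvariants X k) x := by
  refine Fin.cases ?_ (fun k => ?_) k
  · exact (evalDual X genT).analyticAt x
  · exact analyticAt_trace_pow (analyticAt_coMatrix X x) _

omit [Fintype ι] in
theorem fderiv_traceInvariants_zero (x v : ι → ℝ) :
    fderiv ℝ (traceInvariants X 0) x v = evalDual X genT v := by
  have : traceInvariants X 0 = evalDual X genT := rfl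
  rw [this, ContinuousLinearMap.fderiv]

theorem fderiv_traceInvariants_succ (k : Fin (N / 2)) (x v : ι → ℝ) :
    fderiv ℝ (traceInvariants X k.succ) x v =
      ((2 * k.1 + 1 : ℕ) + 1) * (coMatrix X x ^ (2 * k.1 + 1) * coMatrixDeriv X x v).trace := by
  rw [← (analyticAt_traceInvariants X k.succ x).differentiableAt.lineDeriv_eq_fderiv, lineDeriv]
  have h := (hasDerivAt_trace_pow (hasDerivAt_coMatrix X x v) (2 * k.1 + 1)).deriv
  rw [zero_smul, add_zero] at h
  exact h

/-- By cyclicity, the trace of `M ^ m * (M * A - A * M)` vanishes. -/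
theorem coadjointOperator_traceInvariants [DecidableEq ι] (k : Fin (N / 2 + 1)) (i : ι)
    (x : ι → ℝ) : coadjointOperator X i (traceInvariants X k) x = 0 := by
  rw [coadjointOperator_eq]
  refine Fin.cases ?_ (fun k => ?_) k
  · rw [fderiv_traceInvariants_zero, evalDual_coadjointVector, lie_genT]; simp
  · rw [fderiv_traceInvariants_succ, coMatrixDeriv_coadjointVector, mul_sub, ← mul_assoc,
      ← mul_assoc, Matrix.trace_sub, Matrix.trace_mul_comm _ (X i).J.1, ← pow_succ,
      Matrix.trace_mul_comm _ (coMatrix X x), ← mul_assoc, ← pow_succ',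
      Matrix.trace_mul_comm _ (X i).J.1, sub_self, mul_zero]

/-- The differentials are tested on the rotation direction of each plane. For the `l`-th plane,
pairing with `Y ^ (2k+1)` gives `-2(l+1) · (-(l+1)²)^k`, so a relation is a Vandermonde system with
distinct nodes `-(l+1)²`. The direction dual to `T` then settles `c 0`. -/
theorem linearIndependent_fderiv_traceInvariants :
    LinearIndependent ℝ fun k => fderiv ℝ (traceInvariants X k) (regularPoint X) := by
  rw [Fintype.linearIndependent_iff]
  intro c hc
  have hv (v : ι → ℝ) : c 0 * evalDual X genT v + ∑ k : Fin (N / 2), c k.succ *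
      (((2 * k.1 + 1 : ℕ) + 1) * (rotationMatrix N ^ (2 * k.1 + 1) *
        coMatrixDeriv X (regularPoint X) v).trace) = 0 := by
    have := DFunLike.congr_fun hc v
    rw [sum_apply, Fin.sum_univ_succ] at this
    simpa only [smul_apply, smul_eq_mul, fderiv_traceInvariants_zero,
      fderiv_traceInvariants_succ, regularPoint, coMatrix_orthogonalPoint X rotationMatrix_skew,
      zero_apply] using this
  have hsucc : (fun k : Fin (N / 2) => c k.succ * ((2 * k.1 + 1 : ℕ) + 1)) = 0 := by
    refine Matrix.eq_zero_of_forall_index_sum_mul_pow_eq_zero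
      (f := fun l : Fin (N / 2) => -((l.1 : ℝ) + 1) ^ 2) ?_ fun l => ?_
    · intro l l' h
      have h1 : ((l.1 : ℝ) + 1) ^ 2 = ((l'.1 : ℝ) + 1) ^ 2 := neg_injective h
      have h2 := (pow_left_inj₀ (by positivity) (by positivity) two_ne_zero).1 h1
      exact Fin.ext (by exact_mod_cast add_right_cancel h2)
    · have hZ (i j : Fin N) : (Matrix.single (planeFst l) (pairSwap (planeFst l)) (1 : ℝ) -
          Matrix.single (pairSwap (planeFst l)) (planeFst l) 1 : Matrix (Fin N) (Fin N) ℝ) i j =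
          -(Matrix.single (planeFst l) (pairSwap (planeFst l)) (1 : ℝ) -
          Matrix.single (pairSwap (planeFst l)) (planeFst l) 1 : Matrix (Fin N) (Fin N) ℝ) j i := by
        simp only [Matrix.sub_apply, Matrix.single_apply, and_comm]; ring
      have := hv (orthogonalPoint X 0 (Matrix.single (planeFst l) (pairSwap (planeFst l)) (1 : ℝ) -
          Matrix.single (pairSwap (planeFst l)) (planeFst l) 1))
      simp only [regularPoint, coMatrixDeriv_orthogonalPoint X rotationMatrix_skew hZ,
        evalDual_genT_orthogonalPoint, mul_zero, zero_add, mul_sub, Matrix.trace_sub,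
        Matrix.trace_mul_single, MulOpposite.op_one, one_smul, rotationMatrix_pow_odd, pairFreq_pairSwap, pairFreq_planeFst,
        rotationMatrix_skew (pairSwap (planeFst l)) (planeFst l)] at this
      have hM : rotationMatrix N (planeFst l) (pairSwap (planeFst l)) = l.1 + 1 := by
        simp [rotationMatrix, pairCoef_planeFst]
      have hne : (-2 * ((l.1 : ℝ) + 1)) ≠ 0 := by
        have : (0 : ℝ) < l.1 + 1 := by positivity
        linarith
      refine (mul_eq_zero.1 (Eq.trans ?_ this)).resolve_left hne
      rw [Finset.mul_sum]
      refine Finset.sum_congr rfl fun k _ => ?_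
      rw [hM]
      push_cast
      ring
  have hk (k : Fin (N / 2)) : c k.succ = 0 := by
    have h1 : c k.succ * ((2 * k.1 + 1 : ℕ) + 1) = 0 := congrFun hsucc k
    exact (mul_eq_zero.1 h1).resolve_right (by positivity)
  refine Fin.cases ?_ hk
  simpa [hk, evalDual_genT_orthogonalPoint] using hv (orthogonalPoint X 1 0)

end IHa

theorem lemma1 (N : ℕ) (hN : 3 ≤ N) {ι : Type*} [Fintype ι] [DecidableEq ι]
    (X : Module.Basis ι ℝ (IHa N)) :
    (∀ U : Set (ι → ℝ), IsOpen U → U.Nonempty →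
      IsGreatest {m : ℕ | ∃ F : Fin m → (ι → ℝ) → ℝ,
        (∀ a, IsInvariantOn X U (F a)) ∧ FunctionallyIndependentOn U F} (N / 2 + 1)) ∧
    numInvariants X = N / 2 + 1 ∧
    (numInvariants X : ℤ) = (Module.finrank ℝ (IHa N) : ℤ) - 2 * (jZero X : ℤ) :=
  numInvariants_eq_of_invariants X (IHa.analyticAt_traceInvariants X)
    (IHa.coadjointOperator_traceInvariants X) (IHa.linearIndependent_fderiv_traceInvariants X)
    (IHa.regularPoint X) (IHa.card_le_rank_regularPoint X)
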